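/- **Theorem 3.2** (the "theorem on sums"). Write $\mathcal S(n)$ for the set of real symmetric $n\times n$ matrices, with the order $X\le Y$ iff $\langle X\xi,\xi\rangle\le\langle Y\xi,\xi\rangle$ for all $\xi\in\mathbb R^n$, and for $A\in\mathcal S(n)$ put $\|A\|=\sup\{|\lambda| : \lambda \text{ is an eigenvalue of } A\}$. For $\mathcal O\subset\mathbb R^n$, $u:\mathcal O\to\mathbb R$ and $x\in\mathcal O$, let $J^{2,+}_{\mathcal O}u(x)$ be the set of $(p,X)\in\mathbb R^n\times\mathcal S(n)$ with $$u(y)\le u(x)+\langle p,y-x\rangle+\tfrac12\langle X(y-x),y-x\rangle+o(|y-x|^2)\quad\text{as }\mathcal O\ni y\to x,$$ and let $\overline J^{2,+}_{\mathcal O}u(x)$ be the set of $(p,X)\in\mathbb R^n\times\mathcal S(n)$ for which there are $x_n\in\mathcal O$ and $(p_n,X_n)\in J^{2,+}_{\mathcal O}u(x_n)$ with $(x_n,u(x_n),p_n,X_n)\to(x,u(x),p,X)$. For $i=1,\dots,k$ let $\mathcal O_i$ be a locally compact subset of $\mathbb R^{N_i}$ and let $u_i:\mathcal O_i\to\mathbb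 R$ be upper semicontinuous. Put $\mathcal O=\mathcal O_1\times\cdots\times\mathcal O_k\subset\mathbb R^N$, $N=N_1+\cdots+N_k$, let $\varphi$ be a real-valued function that is twice continuously differentiable in an open neighborhood of $\mathcal O$, and set $w(x)=u_1(x_1)+\cdots+u_k(x_k)$ for $x=(x_1,\dots,x_k)\in\mathcal O$. Suppose that $\hat x=(\hat x_1,\dots,\hat x_k)\in\mathcal O$ is a local maximum of $w-\varphi$ relative to $\mathcal O$, and let $A=D^2\varphi(\hat x)\in\mathcal S(N)$. Then for each $\varepsilon>0$ there exist $X_i\in\mathcal S(N_i)$, $i=1,\dots,k$, such that $$(D_{x_i}\varphi(\hat x),X_i)\in\overline J^{2,+}_{\mathcal O_i}u_i(\hat x_i)\quad\text{for } i=1,\dots,k,$$ and the block diagonal matrix with entries $X_1,\dots,X_k$ satisfies $$-\Big(\frac1\varepsilon+\|A\|\Big)I\le\begin{pmatrix}X_1&\cdots&0\\ \vdots&\ddots&\vdots\\ 0&\cdots&X_k\end{pmatrix}\le A+\varepsilon A^2 .$$ -/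

import Mathlib

open Filter Topology

/-- The second-order superjet of `u` at `x` relative to `O ⊆ ℝ^N`: the pairs `(p, X)` with `X`
symmetric and `u y ≤ u x + ⟨p, y - x⟩ + ½ ⟨X (y - x), y - x⟩ + o(|y - x|²)` as `O ∋ y → x`.
It is empty when `x ∉ O`; the values of `u` outside `O` play no role. -/
def superjet {N : ℕ} (O : Set (EuclideanSpace ℝ (Fin N))) (u : EuclideanSpace ℝ (Fin N) → ℝ)
    (x : EuclideanSpace ℝ (Fin N)) :
    Set (EuclideanSpace ℝ (Fin N) × Matrix (Fin N) (Fin N) ℝ) :=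
  {q | x ∈ O ∧ q.2.IsSymm ∧ ∀ c : ℝ, 0 < c → ∀ᶠ y in 𝓝[O] x,
    u y ≤ u x + inner ℝ q.1 (y - x)
      + 1 / 2 * inner ℝ (Matrix.toEuclideanLin q.2 (y - x)) (y - x) + c * ‖y - x‖ ^ 2}

/-- The closed superjet of `u` at `x` relative to `O`: the limits of elements `(p_n, X_n)` of the
superjets of `u` at points `x_n ∈ O` with `x_n → x` and `u (x_n) → u x`. -/
def closedSuperjet {N : ℕ} (O : Set (EuclideanSpace ℝ (Fin N)))
    (u : EuclideanSpace ℝ (Fin N) → ℝ) (x : EuclideanSpace ℝ (Fin N)) :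
    Set (EuclideanSpace ℝ (Fin N) × Matrix (Fin N) (Fin N) ℝ) :=
  {q | x ∈ O ∧ q.2.IsSymm ∧
    ∃ (xs : ℕ → EuclideanSpace ℝ (Fin N)) (ps : ℕ → EuclideanSpace ℝ (Fin N))
      (Xs : ℕ → Matrix (Fin N) (Fin N) ℝ),
      (∀ n, xs n ∈ O ∧ (ps n, Xs n) ∈ superjet O u (xs n)) ∧
      Tendsto xs atTop (𝓝 x) ∧ Tendsto (fun n => u (xs n)) atTop (𝓝 (u x)) ∧
      Tendsto ps atTop (𝓝 q.1) ∧ Tendsto Xs atTop (𝓝 q.2)}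

/-- The `i`-th component `x_i ∈ ℝ^{N_i}` of a vector `x = (x_1, …, x_k)` of
`ℝ^N = ℝ^{N_1} × ⋯ × ℝ^{N_k}`, whose coordinates are indexed by pairs `(i, j)`, `j < N_i`. -/
def block {k : ℕ} {N : Fin k → ℕ} (i : Fin k) (x : EuclideanSpace ℝ (Σ i, Fin (N i))) :
    EuclideanSpace ℝ (Fin (N i)) :=
  WithLp.toLp 2 (fun j => x ⟨i, j⟩)

/-- The product set `O_1 × ⋯ × O_k`. -/
def blockProd {k : ℕ} {N : Fin k → ℕ} (O : (i : Fin k) → Set (EuclideanSpace ℝ (Fin (N i)))) :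
    Set (EuclideanSpace ℝ (Σ i, Fin (N i))) :=
  {x | ∀ i, block i x ∈ O i}

/-- The matrix of second partial derivatives of `φ` at `x`. -/
noncomputable def hessianMatrix {ι : Type*} [Fintype ι] [DecidableEq ι]
    (φ : EuclideanSpace ℝ ι → ℝ) (x : EuclideanSpace ℝ ι) : Matrix ι ι ℝ :=
  Matrix.of fun p q =>
    fderiv ℝ (fderiv ℝ φ) x (EuclideanSpace.single p 1) (EuclideanSpace.single q 1)

/-- `sup {|μ| : μ is an eigenvalue of A}`, the norm of a real symmetric matrix `A`
(it is `0` for the matrix of size `0`). -/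
noncomputable def symmNorm {ι : Type*} [Fintype ι] [DecidableEq ι] (A : Matrix ι ι ℝ) : ℝ :=
  sSup {r | ∃ μ : ℝ, Module.End.HasEigenvalue (Matrix.toLin' A) μ ∧ r = |μ|}

/-! ### Two-sided touching by paraboloids and second-order expansions -/

section Semiconvex

open MeasureTheory Metric

variable {V : Type*} [NormedAddCommGroup V] [InnerProductSpace ℝ V]

/-! Translate `xhat` to the origin and subtract from each `u i` its value and the linear part of
`φ`. Near the origin the sum of the resulting `v i` lies below the form of `A/2` up to a Taylor
error. Young's inequality gives `⟨Ax,x⟩ ≤ ⟨(A + εA²)y,y⟩ + (1/ε + ‖A‖)|x - y|²`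
(`inner_toEuclideanLin_le_add_smul_sq`). So, with `L` slightly above `(1/ε + ‖A‖)/2`, the sum `f` of
the sup-convolutions `sup_z (v i z - L|z - y|²)` lies strictly below half the form of a small
perturbation `M` of `A + εA²` away from the origin, where both vanish.

Every point admits a paraboloid of opening `L` touching `f` from below. The Jensen–Alexandrov
argument is done in one stroke in `exists_second_order_point`. Every small slope `p` is realised at
a maximum of `f` minus the form minus `p`; at such contact points `f` is touched from both sides, so
its gradient `P` is Lipschitz there, and `P - M` maps the contact set onto a ball. The contact set
is therefore not null, and Rademacher's theorem with Lebesgue density yields a contact point near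
the origin where `P` has a derivative `T` relative to the set; integrating along segments gives a
second-order expansion of `f` there.

Since `f` is a sum over separate variables, the form of `T` is block diagonal, and the touching
paraboloids give `-2L ≤ T ≤ M` as forms. A superjet of a sup-convolution at `x` is a superjet of the
original function at the maximising point `z`. This produces approximate superjets
(`exists_approximate_superjets`); their matrices are bounded, and a subsequence converges. -/

/-- A function touched from below by a paraboloid of fixed opening at every point is continuous. -/
theorem continuous_of_touched_below [FiniteDimensional ℝ V] {f : V → ℝ} {L : ℝ}
    (hlow : ∀ x, ∃ q : V, ∀ y, f x + inner ℝ q (y - x) - L * ‖y - x‖ ^ 2 ≤ f y) :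
    Continuous f := by
  -- Adding `L‖y‖²` turns the touching paraboloids into supporting affine functions, and a finite
  -- convex function in finite dimension is locally Lipschitz.
  have hconv : ConvexOn ℝ Set.univ (fun y => f y + L * ‖y‖ ^ 2) := by
    refine ⟨convex_univ, fun x _ y _ a b ha hb hab => ?_⟩
    set z := a • x + b • y with hz
    obtain ⟨q, hq⟩ := hlow z
    have key : ∀ w, f z + L * ‖z‖ ^ 2 + inner ℝ (q + (2 * L) • z) (w - z) ≤ f w + L * ‖w‖ ^ 2 := by
      intro w
      have h1 := hq w
      have h2 : ‖w‖ ^ 2 = ‖z‖ ^ 2 + 2 * inner ℝ z (w - z) + ‖w - z‖ ^ 2 := by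
        rw [← norm_add_sq_real, add_sub_cancel]
      rw [inner_add_left, inner_smul_left, h2]
      simp only [conj_trivial]
      linarith
    have hsum : a * inner ℝ (q + (2 * L) • z) (x - z) + b * inner ℝ (q + (2 * L) • z) (y - z)
        = 0 := by
      rw [← inner_smul_right, ← inner_smul_right, ← inner_add_right]
      have : a • (x - z) + b • (y - z) = 0 := by
        rw [smul_sub, smul_sub, sub_add_sub_comm, ← add_smul, hab, one_smul, ← hz, sub_self]
      rw [this, inner_zero_right]
    have hx := mul_le_mul_of_nonneg_left (key x) ha
    have hy := mul_le_mul_of_nonneg_left (key y) hb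
    have hb' : b = 1 - a := by linarith
    simp only [smul_eq_mul]
    subst hb'
    linarith
  have h1 : Continuous (fun y => f y + L * ‖y‖ ^ 2) := hconv.locallyLipschitz.continuous
  have h2 : f = fun y => (f y + L * ‖y‖ ^ 2) - L * ‖y‖ ^ 2 := by ext y; ring
  rw [h2]
  fun_prop

/-- A linear form bounded below by a quadratic vanishes. -/
theorem eq_zero_of_inner_ge_neg_sq {v : V} {C : ℝ}
    (h : ∀ y : V, -(C * ‖y‖ ^ 2) ≤ inner ℝ v y) : v = 0 := by
  have hC : 0 < |C| + 1 := by positivity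
  -- A small multiple of `-v` makes the linear term dominate the quadratic one.
  have h1 := h (-((|C| + 1)⁻¹ • v))
  rw [inner_neg_right, inner_smul_right, real_inner_self_eq_norm_sq, norm_neg, norm_smul,
    Real.norm_eq_abs, abs_of_pos (inv_pos.2 hC)] at h1
  have h2 : C * ((|C| + 1)⁻¹ * ‖v‖) ^ 2 ≤ |C| * ((|C| + 1)⁻¹ * ‖v‖) ^ 2 :=
    mul_le_mul_of_nonneg_right (le_abs_self C) (by positivity)
  have h3 : (|C| + 1)⁻¹ * ‖v‖ ^ 2 ≤ |C| * ((|C| + 1)⁻¹ * ‖v‖) ^ 2 := by linarith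
  have h4 : ‖v‖ ^ 2 * (|C| + 1) ≤ |C| * ‖v‖ ^ 2 := by
    have := mul_le_mul_of_nonneg_left h3 (sq_nonneg (|C| + 1))
    field_simp at this
    nlinarith
  have h5 : ‖v‖ ^ 2 ≤ 0 := by nlinarith [sq_nonneg ‖v‖]
  have h6 : ‖v‖ = 0 := by nlinarith [norm_nonneg v]
  exact norm_eq_zero.1 h6

/-- If `f` lies strictly below the quadratic form of `M`, then `f` minus this form and minus a small
linear form attains its maximum close to the origin. -/
theorem exists_touched_above [FiniteDimensional ℝ V] {f : V → ℝ} (hf : Continuous f)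
    {M : V →L[ℝ] V} (hM : ∀ x y, inner ℝ (M x) y = inner ℝ (M y) x) {δ : ℝ} (hδ : 0 < δ)
    (h0 : f 0 = 0) (hup : ∀ y, f y ≤ 1 / 2 * inner ℝ (M y) y - δ * ‖y‖ ^ 2) (p : V) :
    ∃ x, δ * ‖x‖ ≤ ‖p‖ ∧
      ∀ y, f y ≤ f x + inner ℝ (p + M x) (y - x) + 1 / 2 * inner ℝ (M (y - x)) (y - x) := by
  have hF : Continuous (fun y => f y - 1 / 2 * inner ℝ (M y) y - inner ℝ p y) := by fun_prop
  have hr : 0 ≤ ‖p‖ / δ := by positivity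
  -- Beyond radius `‖p‖ / δ` the gap `δ‖y‖²` exceeds `‖p‖‖y‖`, so the function is below its value
  -- `0` at the origin and the maximum on the ball is global.
  obtain ⟨x, hx, hmax⟩ := (isCompact_closedBall (0 : V) (‖p‖ / δ)).exists_isMaxOn
    ⟨0, mem_closedBall_self hr⟩ hF.continuousOn
  rw [mem_closedBall_zero_iff, le_div_iff₀ hδ] at hx
  have hglob : ∀ y, f y - 1 / 2 * inner ℝ (M y) y - inner ℝ p y
      ≤ f x - 1 / 2 * inner ℝ (M x) x - inner ℝ p x := by
    intro y
    by_cases hy : y ∈ closedBall (0 : V) (‖p‖ / δ)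
    · exact hmax hy
    · have h1 : f 0 - 1 / 2 * inner ℝ (M 0) 0 - inner ℝ p 0
        ≤ f x - 1 / 2 * inner ℝ (M x) x - inner ℝ p x := hmax (mem_closedBall_self hr)
      simp only [h0, map_zero, inner_zero_right] at h1
      rw [mem_closedBall_zero_iff, not_le, div_lt_iff₀ hδ] at hy
      have h2 := hup y
      have h3 := neg_le_of_abs_le (abs_real_inner_le_norm p y)
      nlinarith [norm_nonneg y]
  refine ⟨x, by linarith, fun y => ?_⟩
  have h1 := hglob y
  have h2 : inner ℝ (M y) y = inner ℝ (M x) x + 2 * inner ℝ (M x) (y - x)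
      + inner ℝ (M (y - x)) (y - x) := by
    simp only [map_sub, inner_sub_left, inner_sub_right]
    rw [hM y x]
    ring
  rw [h2] at h1
  rw [inner_add_left, inner_sub_right p]
  linarith

/-- The gradient of `f` is Lipschitz on a set of points at which `f` is touched from both sides by
paraboloids of fixed opening. -/
theorem norm_sub_le_of_two_sided {f : V → ℝ} {K : ℝ} (hK : 0 ≤ K) {P : V → V} {E : Set V}
    (hE : ∀ x ∈ E, ∀ y, |f y - f x - inner ℝ (P x) (y - x)| ≤ K * ‖y - x‖ ^ 2)
    {x x' : V} (hx : x ∈ E) (hx' : x' ∈ E) : ‖P x' - P x‖ ≤ 6 * K * ‖x' - x‖ := by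
  set d := x' - x with hd
  set v := P x' - P x with hv
  -- Estimate `f (x' + h)` from `x` and from `x'`, and `f x'` from `x`: the values of `f` cancel and
  -- only the difference of the slopes remains.
  have main : ∀ h : V, inner ℝ v h ≤ 3 * K * (‖d‖ ^ 2 + ‖h‖ ^ 2) := by
    intro h
    have h1 := (abs_le.1 (hE x hx (x' + h))).2
    have h2 := (abs_le.1 (hE x' hx' (x' + h))).1
    have h3 := (abs_le.1 (hE x hx x')).1
    have e1 : x' + h - x = d + h := by rw [hd]; abel
    rw [e1, inner_add_right] at h1
    rw [add_sub_cancel_left] at h2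
    rw [← hd] at h3
    have h4 : ‖d + h‖ ^ 2 ≤ 2 * (‖d‖ ^ 2 + ‖h‖ ^ 2) := by
      have := norm_add_le d h
      nlinarith [sq_nonneg (‖d‖ - ‖h‖), norm_nonneg (d + h)]
    have h5 := mul_le_mul_of_nonneg_left h4 hK
    rw [hv, inner_sub_left]
    nlinarith
  rcases eq_or_ne v 0 with h0 | h0
  · rw [h0, norm_zero]; positivity
  have hvpos : 0 < ‖v‖ := norm_pos_iff.2 h0
  rcases eq_or_ne d 0 with hd0 | hd0
  · exact absurd (by rw [hv, sub_eq_zero.1 (hd.symm.trans hd0), sub_self]) h0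
  have hdpos : 0 < ‖d‖ := norm_pos_iff.2 hd0
  -- The direction of `v` with length `‖d‖` balances the two squares.
  have h1 := main ((‖d‖ / ‖v‖) • v)
  rw [inner_smul_right, real_inner_self_eq_norm_sq, norm_smul, Real.norm_eq_abs,
    abs_of_pos (by positivity), div_mul_cancel₀ _ hvpos.ne'] at h1
  have h2 : ‖d‖ / ‖v‖ * ‖v‖ ^ 2 = ‖d‖ * ‖v‖ := by field_simp
  rw [h2] at h1
  have : ‖d‖ * ‖v‖ ≤ ‖d‖ * (6 * K * ‖d‖) := by linarith
  exact le_of_mul_le_mul_left this hdpos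

/-- Second-order expansion at a density point of a set of points with two-sided touching
paraboloids, provided that the gradient is differentiable relative to this set. -/
theorem second_order_expansion_of_density {f : V → ℝ} {K : ℝ} (hK : 0 ≤ K) {P : V → V} {E : Set V}
    (hE : ∀ x ∈ E, ∀ y, |f y - f x - inner ℝ (P x) (y - x)| ≤ K * ‖y - x‖ ^ 2)
    {x : V} {T : V →L[ℝ] V} (hT : HasFDerivWithinAt P T E x)
    (hdens : ∀ η > 0, ∀ᶠ z in 𝓝 x, ∃ e ∈ E, ‖e - z‖ ≤ η * ‖z - x‖) {c : ℝ} (hc : 0 < c) :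
    ∀ᶠ y in 𝓝 x, |f y - f x - inner ℝ (P x) (y - x) - 1 / 2 * inner ℝ (T (y - x)) (y - x)|
      ≤ c * ‖y - x‖ ^ 2 := by
  -- The segment is cut into `m` pieces, each costing at most `C‖h‖²/m²`, so the total error is
  -- `C‖h‖²/m`. The part `8K` comes from expanding `f` at both ends of a piece around a point of
  -- `E`, and `‖T‖ + 2` from the slope there.
  set C := 8 * K + ‖T‖ + 2 with hC
  have hCpos : 0 < C := by positivity
  obtain ⟨m, hm⟩ := exists_nat_gt (C / c)
  have hm0 : (0 : ℝ) < m := lt_trans (by positivity) hm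
  have hm1 : (1 : ℝ) ≤ m := by
    have : 0 < m := by exact_mod_cast hm0
    exact_mod_cast this
  have hη : (0 : ℝ) < 1 / m := by positivity
  have hη1 : (1 : ℝ) / m ≤ 1 := by rw [div_le_one hm0]; exact hm1
  have hder := (hasFDerivWithinAt_iff_isLittleO.1 hT).def hη
  obtain ⟨r₁, hr₁, hball₁⟩ := Metric.mem_nhds_iff.1 (hdens _ hη)
  obtain ⟨r₂, hr₂, hball₂⟩ := Metric.mem_nhdsWithin_iff.1 hder
  filter_upwards [Metric.ball_mem_nhds x (lt_min hr₁ (half_pos hr₂))] with y hy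
  set h := y - x with hh
  have hyn : ‖h‖ < min r₁ (r₂ / 2) := by rwa [mem_ball_iff_norm] at hy
  have hh₁ : ‖h‖ < r₁ := lt_of_lt_of_le hyn (min_le_left _ _)
  have hh₂ : ‖h‖ < r₂ / 2 := lt_of_lt_of_le hyn (min_le_right _ _)
  -- near each point of the segment there is a point of `E` where the gradient is almost affine
  have approx : ∀ t : ℝ, 0 ≤ t → t ≤ 1 → ∃ e ∈ E, ‖e - (x + t • h)‖ ≤ 1 / m * ‖h‖ ∧
      ‖P e - P x - T (e - x)‖ ≤ 2 * (1 / m) * ‖h‖ := by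
    intro t ht0 ht1
    have hth : ‖t • h‖ ≤ ‖h‖ := by
      rw [norm_smul, Real.norm_eq_abs, abs_of_nonneg ht0]
      exact mul_le_of_le_one_left (norm_nonneg _) ht1
    have hz : x + t • h ∈ ball x r₁ := by
      rw [mem_ball_iff_norm, add_sub_cancel_left]
      exact lt_of_le_of_lt hth hh₁
    obtain ⟨e, heE, he⟩ := hball₁ hz
    rw [add_sub_cancel_left] at he
    have he' : ‖e - (x + t • h)‖ ≤ 1 / m * ‖h‖ := he.trans (by gcongr)
    have hex : ‖e - x‖ ≤ 2 * ‖h‖ := by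
      have e1 : e - x = (e - (x + t • h)) + t • h := by abel
      rw [e1]
      refine (norm_add_le _ _).trans ?_
      have : 1 / (m : ℝ) * ‖h‖ ≤ 1 * ‖h‖ := by gcongr
      linarith
    have heb : e ∈ ball x r₂ := by
      rw [mem_ball_iff_norm]; linarith
    have hP : ‖P e - P x - T (e - x)‖ ≤ 1 / m * ‖e - x‖ := hball₂ ⟨heb, heE⟩
    refine ⟨e, heE, he', hP.trans ?_⟩
    have := mul_le_mul_of_nonneg_left hex hη.le
    linarith
  set Ψ : ℝ → ℝ := fun t => f (x + t • h) - f x - t * inner ℝ (P x) h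
    - t ^ 2 / 2 * inner ℝ (T h) h with hΨ
  have step : ∀ j : ℕ, j < m → |Ψ ((j + 1 : ℝ) / m) - Ψ ((j : ℝ) / m)| ≤ C / m ^ 2 * ‖h‖ ^ 2 := by
    intro j hj
    have hj' : (j : ℝ) + 1 ≤ m := by exact_mod_cast hj
    set t := (j : ℝ) / m with ht
    set s := ((j : ℝ) + 1) / m with hs
    have hst : s - t = 1 / m := by rw [hs, ht]; ring
    have ht0 : 0 ≤ t := by positivity
    have hs1 : s ≤ 1 := by rw [hs, div_le_one hm0]; exact hj'
    -- With the midpoint the quadratic term is matched exactly, as `(s² - t²)/2 = (s - t)(s + t)/2`.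
    obtain ⟨e, heE, he, hPe⟩ := approx ((s + t) / 2) (by linarith) (by linarith)
    set w := e - (x + ((s + t) / 2) • h) with hw
    have hnear : ∀ a : ℝ, |a - (s + t) / 2| ≤ 1 / m →
        ‖x + a • h - e‖ ^ 2 ≤ 4 * (1 / m) ^ 2 * ‖h‖ ^ 2 := by
      intro a ha
      have e1 : x + a • h - e = (a - (s + t) / 2) • h - w := by rw [hw, sub_smul]; abel
      have e2 : ‖x + a • h - e‖ ≤ 2 * (1 / m) * ‖h‖ := by
        rw [e1]
        refine (norm_sub_le _ _).trans ?_
        rw [norm_smul, Real.norm_eq_abs]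
        have := mul_le_mul_of_nonneg_right ha (norm_nonneg h)
        linarith
      calc ‖x + a • h - e‖ ^ 2 ≤ (2 * (1 / m) * ‖h‖) ^ 2 := by gcongr
        _ = _ := by ring
    have hns := hnear s (by rw [abs_le]; constructor <;> linarith)
    have hnt := hnear t (by rw [abs_le]; constructor <;> linarith)
    have hs' := (hE e heE (x + s • h)).trans (mul_le_mul_of_nonneg_left hns hK)
    have ht' := (hE e heE (x + t • h)).trans (mul_le_mul_of_nonneg_left hnt hK)
    have hin : inner ℝ (P e) (x + s • h - e) - inner ℝ (P e) (x + t • h - e)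
        = (s - t) * inner ℝ (P e) h := by
      rw [← inner_sub_right, ← inner_smul_right, sub_smul]
      congr 1; abel
    have hPdec : inner ℝ (P e) h = inner ℝ (P x) h + (s + t) / 2 * inner ℝ (T h) h
        + (inner ℝ (P e - P x - T (e - x)) h + inner ℝ (T w) h) := by
      have : T w = T (e - x) - ((s + t) / 2) • T h := by
        rw [← map_smul, ← map_sub, hw]; congr 1; abel
      rw [this]
      simp only [inner_sub_left, inner_smul_left, conj_trivial]
      ring
    have herr : |inner ℝ (P e - P x - T (e - x)) h + inner ℝ (T w) h|
        ≤ (2 + ‖T‖) * (1 / m) * ‖h‖ ^ 2 := by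
      refine (abs_add_le _ _).trans ?_
      have h1 := (abs_real_inner_le_norm (P e - P x - T (e - x)) h).trans
        (mul_le_mul_of_nonneg_right hPe (norm_nonneg h))
      have h2 : |inner ℝ (T w) h| ≤ ‖T‖ * (1 / m * ‖h‖) * ‖h‖ :=
        (abs_real_inner_le_norm (T w) h).trans (mul_le_mul_of_nonneg_right
          ((T.le_opNorm w).trans (by gcongr)) (norm_nonneg h))
      linarith
    have hΨst : Ψ s - Ψ t = (f (x + s • h) - f e - inner ℝ (P e) (x + s • h - e))
        - (f (x + t • h) - f e - inner ℝ (P e) (x + t • h - e))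
        + 1 / m * (inner ℝ (P e - P x - T (e - x)) h + inner ℝ (T w) h) := by
      have : inner ℝ (P e) (x + s • h - e) = inner ℝ (P e) (x + t • h - e)
        + (s - t) * inner ℝ (P e) h := by linarith
      rw [this, hPdec, ← hst]
      simp only [hΨ]
      ring
    rw [hΨst]
    have h3 : |1 / (m : ℝ) * (inner ℝ (P e - P x - T (e - x)) h + inner ℝ (T w) h)|
        ≤ 1 / m * ((2 + ‖T‖) * (1 / m) * ‖h‖ ^ 2) := by
      rw [abs_mul, abs_of_pos hη]
      exact mul_le_mul_of_nonneg_left herr hη.le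
    have h4 : C / m ^ 2 * ‖h‖ ^ 2 = K * (4 * (1 / m) ^ 2 * ‖h‖ ^ 2) + K * (4 * (1 / m) ^ 2 * ‖h‖ ^ 2)
        + 1 / m * ((2 + ‖T‖) * (1 / m) * ‖h‖ ^ 2) := by
      rw [hC]; field_simp; ring
    rw [h4]
    refine (abs_add_le _ _).trans (add_le_add ((abs_sub _ _).trans (add_le_add hs' ht')) h3)
  have chain : ∀ j : ℕ, j ≤ m → |Ψ ((j : ℝ) / m)| ≤ j * (C / m ^ 2 * ‖h‖ ^ 2) := by
    intro j
    induction j with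
    | zero => intro _; simp [hΨ]
    | succ j ih =>
      intro hj
      have h1 := ih (by omega)
      have h2 := step j (by omega)
      push_cast
      have h3 : Ψ (((j : ℝ) + 1) / m) = Ψ ((j : ℝ) / m)
        + (Ψ (((j : ℝ) + 1) / m) - Ψ ((j : ℝ) / m)) := by ring
      rw [h3]
      refine (abs_add_le _ _).trans ?_
      linarith
  have hfin := chain m le_rfl
  rw [div_self hm0.ne'] at hfin
  have hΨ1 : Ψ 1 = f y - f x - inner ℝ (P x) h - 1 / 2 * inner ℝ (T h) h := by
    simp only [hΨ, one_smul, hh, add_sub_cancel]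
    ring
  rw [hΨ1] at hfin
  refine hfin.trans ?_
  have h5 : (m : ℝ) * (C / m ^ 2 * ‖h‖ ^ 2) = C / m * ‖h‖ ^ 2 := by field_simp
  rw [h5]
  have : C / m ≤ c := by
    rw [div_le_iff₀ hm0]
    have := (div_lt_iff₀ hc).1 hm
    linarith
  gcongr

end Semiconvex

/-! ### Density points and the Jensen–Alexandrov argument -/

section Density

open MeasureTheory Metric

variable {V : Type*} [NormedAddCommGroup V] [InnerProductSpace ℝ V] [FiniteDimensional ℝ V]
  [MeasurableSpace V] [BorelSpace V]

/-- Almost every point of a set `E` can be approached by points of `E` in every direction. -/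
theorem ae_restrict_forall_exists_near (μ : Measure V) [μ.IsAddHaarMeasure] (E : Set V) :
    ∀ᵐ x ∂μ.restrict E, ∀ η > 0, ∀ᶠ z in 𝓝[≠] x, ∃ e ∈ E, ‖e - z‖ ≤ η * ‖z - x‖ := by
  have key : ∀ n : ℕ, ∀ᵐ x ∂μ.restrict E,
      ∀ᶠ z in 𝓝[≠] x, ∃ e ∈ E, ‖e - z‖ ≤ 1 / ((n : ℝ) + 1) * ‖z - x‖ := by
    intro n
    have hη : (0 : ℝ) < 1 / ((n : ℝ) + 1) := by positivity
    filter_upwards [IsUnifLocDoublingMeasure.ae_tendsto_measure_inter_div μ E ((n : ℝ) + 1)]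
      with x hx
    -- The balls about `z` of radius `‖z - x‖/(n + 1)` need not contain `x`, but their dilates by `n
    -- + 1` do; the density theorem for such balls forces them to meet `E`.
    have hlim := hx (l := 𝓝[≠] x) (fun z => z) (fun z => 1 / ((n : ℝ) + 1) * ‖z - x‖) (by
      refine tendsto_nhdsWithin_iff.2 ⟨?_, ?_⟩
      · refine Tendsto.mono_left ?_ nhdsWithin_le_nhds
        have : Continuous (fun z => 1 / ((n : ℝ) + 1) * ‖z - x‖) := by fun_prop
        simpa using this.tendsto x
      · filter_upwards [self_mem_nhdsWithin] with z hz
        exact mul_pos hη (norm_pos_iff.2 (sub_ne_zero.2 hz))) (by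
      refine Eventually.of_forall fun z => ?_
      rw [mem_closedBall, dist_comm, dist_eq_norm]
      apply le_of_eq
      field_simp)
    filter_upwards [hlim.eventually_ne one_ne_zero] with z hz
    have hne : (E ∩ closedBall z (1 / ((n : ℝ) + 1) * ‖z - x‖)).Nonempty := by
      by_contra h
      rw [Set.not_nonempty_iff_eq_empty] at h
      rw [h] at hz
      simp at hz
    obtain ⟨e, heE, he⟩ := hne
    exact ⟨e, heE, by rwa [mem_closedBall, dist_eq_norm] at he⟩
  filter_upwards [ae_all_iff.2 key] with x hx η hη
  obtain ⟨n, hn⟩ := exists_nat_one_div_lt hη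
  filter_upwards [hx n] with z ⟨e, heE, he⟩
  exact ⟨e, heE, he.trans (by gcongr)⟩

/-- A set which a Lipschitz map sends onto a ball contains a point which is a density point and at
which a second Lipschitz map is differentiable relative to the set. -/
theorem exists_density_point_hasFDerivWithinAt {E : Set V} {P G : V → V} {CP CG : NNReal}
    (hP : LipschitzOnWith CP P E) (hG : LipschitzOnWith CG G E) {ρ : ℝ} (hρ : 0 < ρ)
    (hball : ball 0 ρ ⊆ G '' E) :
    ∃ x ∈ E, ∃ T : V →L[ℝ] V, HasFDerivWithinAt P T E x ∧
      ∀ η > 0, ∀ᶠ z in 𝓝 x, ∃ e ∈ E, ‖e - z‖ ≤ η * ‖z - x‖ := by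
  -- In the top dimension this is a Haar measure, and Lipschitz maps send its null sets to null
  -- sets.
  set μ : Measure V := Measure.hausdorffMeasure (Module.finrank ℝ V) with hμ
  by_contra hcon
  have h1 : ∀ᵐ x ∂μ.restrict E, x ∈ E → DifferentiableWithinAt ℝ P E x :=
    ae_mono Measure.restrict_le_self hP.ae_differentiableWithinAt_of_mem
  have h2 : ∀ᵐ x ∂μ.restrict E, x ∉ E := by
    filter_upwards [h1, ae_restrict_forall_exists_near μ E] with x hx1 hx2 hxE
    refine hcon ⟨x, hxE, _, (hx1 hxE).hasFDerivWithinAt, fun η hη => ?_⟩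
    have h3 := hx2 η hη
    rw [eventually_nhdsWithin_iff] at h3
    filter_upwards [h3] with z hz
    rcases eq_or_ne z x with rfl | hne
    · exact ⟨z, hxE, by simp⟩
    · exact hz hne
  have h3 : μ E = 0 := by
    have h4 : μ.restrict E E = 0 := by
      have := ae_iff.1 h2
      simpa using this
    simpa using h4
  have h4 : μ (G '' E) = 0 := by
    have := hG.hausdorffMeasure_image_le (d := (Module.finrank ℝ V : ℝ)) (Nat.cast_nonneg _)
    rw [← hμ, h3, mul_zero] at this
    exact le_antisymm this bot_le
  exact (isOpen_ball.measure_pos μ ⟨0, mem_ball_self hρ⟩).ne' (measure_mono_null hball h4)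

/-- A function which is touched from below everywhere by paraboloids of fixed opening and lies
strictly below a quadratic form with contact at the origin has second-order expansions at points
arbitrarily close to the origin, where it is touched from above by a translate of that form. -/
theorem exists_second_order_point {V : Type*} [NormedAddCommGroup V] [InnerProductSpace ℝ V]
    [FiniteDimensional ℝ V] {f : V → ℝ} {L : ℝ}
    (hlow : ∀ x, ∃ q : V, ∀ y, f x + inner ℝ q (y - x) - L * ‖y - x‖ ^ 2 ≤ f y)
    {M : V →L[ℝ] V} (hM : ∀ x y, inner ℝ (M x) y = inner ℝ (M y) x) {δ : ℝ} (hδ : 0 < δ)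
    (h0 : f 0 = 0) (hup : ∀ y, f y ≤ 1 / 2 * inner ℝ (M y) y - δ * ‖y‖ ^ 2) {ρ : ℝ} (hρ : 0 < ρ) :
    ∃ (x q : V) (T : V →L[ℝ] V), ‖x‖ ≤ ρ ∧ ‖q‖ ≤ ρ ∧
      (∀ y, f x + inner ℝ q (y - x) - L * ‖y - x‖ ^ 2 ≤ f y) ∧
      (∀ y, f y ≤ f x + inner ℝ q (y - x) + 1 / 2 * inner ℝ (M (y - x)) (y - x)) ∧
      ∀ c > 0, ∀ᶠ y in 𝓝 x, |f y - f x - inner ℝ q (y - x) - 1 / 2 * inner ℝ (T (y - x)) (y - x)|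
        ≤ c * ‖y - x‖ ^ 2 := by
  borelize V
  have hf := continuous_of_touched_below hlow
  choose P hP using hlow
  have hM1 : 0 < 1 + ‖M‖ / δ := by positivity
  -- On `E`, `δ‖x‖ ≤ κ` and `‖P x‖ ≤ κ + ‖M‖κ/δ`; the two entries of the minimum bound these by `δρ`
  -- and `ρ`.
  set κ := min (δ * ρ) (ρ / (1 + ‖M‖ / δ)) with hκ
  have hκpos : 0 < κ := lt_min (by positivity) (by positivity)
  set G : V → V := fun x => P x - M x with hG
  set E : Set V := {x | ‖G x‖ < κ ∧ δ * ‖x‖ ≤ ‖G x‖ ∧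
    ∀ y, f y ≤ f x + inner ℝ (P x) (y - x) + 1 / 2 * inner ℝ (M (y - x)) (y - x)} with hEdef
  set K := max L ‖M‖ with hKdef
  have hK : 0 ≤ K := le_max_of_le_right (norm_nonneg _)
  have hMle : ∀ h : V, 1 / 2 * inner ℝ (M h) h ≤ K * ‖h‖ ^ 2 := by
    intro h
    have h1 : inner ℝ (M h) h ≤ ‖M‖ * ‖h‖ * ‖h‖ :=
      (real_inner_le_norm _ _).trans (mul_le_mul_of_nonneg_right (M.le_opNorm h) (norm_nonneg h))
    have h2 : ‖M‖ * ‖h‖ ^ 2 ≤ K * ‖h‖ ^ 2 :=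
      mul_le_mul_of_nonneg_right (le_max_right _ _) (sq_nonneg _)
    have h3 : 0 ≤ ‖M‖ * ‖h‖ ^ 2 := by positivity
    linarith
  have hLle : ∀ h : V, L * ‖h‖ ^ 2 ≤ K * ‖h‖ ^ 2 := fun h =>
    mul_le_mul_of_nonneg_right (le_max_left _ _) (sq_nonneg _)
  have htwo : ∀ x ∈ E, ∀ y, |f y - f x - inner ℝ (P x) (y - x)| ≤ K * ‖y - x‖ ^ 2 := by
    intro x hx y
    have h1 := hP x y
    have h2 := hx.2.2 y
    have h3 := hMle (y - x)
    have h4 := hLle (y - x)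
    rw [abs_le]
    constructor <;> linarith
  have hPlip : LipschitzOnWith (Real.toNNReal (6 * K)) P E := by
    refine LipschitzOnWith.of_dist_le_mul fun x hx y hy => ?_
    rw [dist_eq_norm, dist_eq_norm, Real.coe_toNNReal _ (by positivity)]
    exact norm_sub_le_of_two_sided hK htwo hy hx
  have hGlip : LipschitzOnWith (Real.toNNReal (6 * K + ‖M‖)) G E := by
    refine LipschitzOnWith.of_dist_le_mul fun x hx y hy => ?_
    rw [dist_eq_norm, dist_eq_norm, Real.coe_toNNReal _ (by positivity)]
    have e1 : G x - G y = (P x - P y) - M (x - y) := by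
      simp only [hG, map_sub]; abel
    rw [e1, add_mul]
    exact (norm_sub_le _ _).trans
      (add_le_add (norm_sub_le_of_two_sided hK htwo hy hx) (M.le_opNorm _))
  have hsurj : ball 0 κ ⊆ G '' E := by
    intro p hp
    rw [mem_ball_zero_iff] at hp
    obtain ⟨x, hxn, hx⟩ := exists_touched_above hf hM hδ h0 hup p
    -- Slopes of paraboloids touching from below and from above at one point agree, so the arbitrary
    -- choice `P` is forced at contact points.
    have hpx : P x = p + M x := by
      have : p + M x - P x = 0 := by
        refine eq_zero_of_inner_ge_neg_sq (C := 2 * K) fun h => ?_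
        have h1 := hx (x + h)
        have h2 := hP x (x + h)
        rw [add_sub_cancel_left] at h1 h2
        have h3 := hMle h
        have h4 := hLle h
        rw [inner_sub_left]
        linarith
      exact (sub_eq_zero.1 this).symm
    have hGx : G x = p := by simp only [hG, hpx, add_sub_cancel_right]
    refine ⟨x, ⟨?_, ?_, ?_⟩, hGx⟩
    · rwa [hGx]
    · rwa [hGx]
    · rwa [hpx]
  obtain ⟨x, hxE, T, hT, hdens⟩ := exists_density_point_hasFDerivWithinAt hPlip hGlip hκpos hsurj
  have hGx : ‖G x‖ ≤ κ := hxE.1.le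
  have hxκ : δ * ‖x‖ ≤ κ := hxE.2.1.trans hGx
  refine ⟨x, P x, T, ?_, ?_, hP x, hxE.2.2, fun c hc =>
    second_order_expansion_of_density hK htwo hT hdens hc⟩
  · exact le_of_mul_le_mul_left (hxκ.trans (min_le_left _ _)) hδ
  · have e1 : P x = G x + M x := by simp only [hG, sub_add_cancel]
    have h1 : ‖x‖ ≤ κ / δ := by rw [le_div_iff₀ hδ]; linarith
    have h2 : κ ≤ ρ / (1 + ‖M‖ / δ) := min_le_right _ _
    rw [le_div_iff₀ hM1] at h2
    rw [e1]
    calc ‖G x + M x‖ ≤ ‖G x‖ + ‖M‖ * ‖x‖ := (norm_add_le _ _).trans (by gcongr; exact M.le_opNorm x)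
      _ ≤ κ + ‖M‖ * (κ / δ) := by gcongr
      _ = κ * (1 + ‖M‖ / δ) := by ring
      _ ≤ ρ := h2

end Density

/-! ### Block decomposition of vectors and matrices -/

section Blocks

variable {k : ℕ} {N : Fin k → ℕ}

theorem block_inner (x y : EuclideanSpace ℝ (Σ i, Fin (N i))) :
    inner ℝ x y = ∑ i, inner ℝ (block i x) (block i y) := by
  simp only [PiLp.inner_apply, Fintype.sum_sigma]
  rfl

theorem block_norm_sq (x : EuclideanSpace ℝ (Σ i, Fin (N i))) :
    ‖x‖ ^ 2 = ∑ i, ‖block i x‖ ^ 2 := by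
  simp only [← real_inner_self_eq_norm_sq, block_inner]

theorem norm_block_le (x : EuclideanSpace ℝ (Σ i, Fin (N i))) (i : Fin k) :
    ‖block i x‖ ≤ ‖x‖ := by
  have h : ‖block i x‖ ^ 2 ≤ ‖x‖ ^ 2 := by
    rw [block_norm_sq x]
    exact Finset.single_le_sum (f := fun j => ‖block j x‖ ^ 2) (fun j _ => sq_nonneg _)
      (Finset.mem_univ i)
  exact le_of_sq_le_sq h (norm_nonneg _)

theorem block_add (i : Fin k) (x y : EuclideanSpace ℝ (Σ i, Fin (N i))) :
    block i (x + y) = block i x + block i y := rfl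

theorem block_sub (i : Fin k) (x y : EuclideanSpace ℝ (Σ i, Fin (N i))) :
    block i (x - y) = block i x - block i y := rfl

theorem block_smul (i : Fin k) (c : ℝ) (x : EuclideanSpace ℝ (Σ i, Fin (N i))) :
    block i (c • x) = c • block i x := rfl

theorem block_zero (i : Fin k) : block i (0 : EuclideanSpace ℝ (Σ i, Fin (N i))) = 0 := rfl

/-- The vector with given components. -/
def glue (y : (i : Fin k) → EuclideanSpace ℝ (Fin (N i))) :
    EuclideanSpace ℝ (Σ i, Fin (N i)) :=
  WithLp.toLp 2 (fun s => y s.1 s.2)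

@[simp] theorem block_glue (y : (i : Fin k) → EuclideanSpace ℝ (Fin (N i))) (i : Fin k) :
    block i (glue y) = y i := rfl

/-- The inclusion of the `i`-th factor. -/
noncomputable def incl (i : Fin k) :
    EuclideanSpace ℝ (Fin (N i)) →ₗ[ℝ] EuclideanSpace ℝ (Σ i, Fin (N i)) where
  toFun h := glue (Pi.single i h)
  map_add' x y := by rw [Pi.single_add]; rfl
  map_smul' c x := by rw [Pi.single_smul]; rfl

theorem block_incl (i j : Fin k) (h : EuclideanSpace ℝ (Fin (N i))) :
    block j (incl i h) = Pi.single (M := fun i => EuclideanSpace ℝ (Fin (N i))) i h j := rfl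

@[simp] theorem block_incl_self (i : Fin k) (h : EuclideanSpace ℝ (Fin (N i))) :
    block i (incl i h) = h := by
  rw [block_incl, Pi.single_eq_same]

theorem block_incl_ne {i j : Fin k} (hij : j ≠ i) (h : EuclideanSpace ℝ (Fin (N i))) :
    block j (incl i h) = 0 := by
  rw [block_incl, Pi.single_eq_of_ne hij]

theorem inner_incl (x : EuclideanSpace ℝ (Σ i, Fin (N i))) (i : Fin k)
    (h : EuclideanSpace ℝ (Fin (N i))) : inner ℝ x (incl i h) = inner ℝ (block i x) h := by
  rw [block_inner, Finset.sum_eq_single i]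
  · rw [block_incl_self]
  · intro j _ hj
    rw [block_incl_ne hj, inner_zero_right]
  · simp

theorem norm_incl (i : Fin k) (h : EuclideanSpace ℝ (Fin (N i))) : ‖incl i h‖ = ‖h‖ := by
  rw [← sq_eq_sq₀ (norm_nonneg _) (norm_nonneg _), ← real_inner_self_eq_norm_sq, inner_incl,
    block_incl_self, real_inner_self_eq_norm_sq]

/-- Only one summand changes along one factor; this isolates a single function from an expansion of
the sum. -/
theorem sum_block_add_incl_sub (F : (i : Fin k) → EuclideanSpace ℝ (Fin (N i)) → ℝ)
    (x : EuclideanSpace ℝ (Σ i, Fin (N i))) (i : Fin k) (d : EuclideanSpace ℝ (Fin (N i))) :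
    (∑ j, F j (block j (x + incl i d))) - ∑ j, F j (block j x)
      = F i (block i x + d) - F i (block i x) := by
  rw [← Finset.sum_sub_distrib, Finset.sum_eq_single i]
  · rw [block_add, block_incl_self]
  · intro j _ hj
    rw [block_add, block_incl_ne hj, add_zero, sub_self]
  · simp

theorem block_toEuclideanLin_blockDiagonal' (X : (i : Fin k) → Matrix (Fin (N i)) (Fin (N i)) ℝ)
    (h : EuclideanSpace ℝ (Σ i, Fin (N i))) (i : Fin k) :
    block i (Matrix.toEuclideanLin (Matrix.blockDiagonal' X) h)
      = Matrix.toEuclideanLin (X i) (block i h) := by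
  ext j
  simp only [block, Matrix.toLpLin_apply, Matrix.mulVec, dotProduct, Fintype.sum_sigma]
  rw [Finset.sum_eq_single i]
  · simp [Matrix.blockDiagonal'_apply_eq]
  · intro l _ hl
    refine Finset.sum_eq_zero fun a _ => ?_
    rw [Matrix.blockDiagonal'_apply_ne _ _ _ hl.symm, zero_mul]
  · simp

theorem inner_toEuclideanLin_blockDiagonal'
    (X : (i : Fin k) → Matrix (Fin (N i)) (Fin (N i)) ℝ)
    (h : EuclideanSpace ℝ (Σ i, Fin (N i))) :
    inner ℝ (Matrix.toEuclideanLin (Matrix.blockDiagonal' X) h) h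
      = ∑ i, inner ℝ (Matrix.toEuclideanLin (X i) (block i h)) (block i h) := by
  rw [block_inner]
  simp only [block_toEuclideanLin_blockDiagonal']

/-- The quadratic form of a linear map is the quadratic form of a symmetric matrix. -/
theorem exists_isSymm_inner_toEuclideanLin {n : ℕ}
    (S : EuclideanSpace ℝ (Fin n) →ₗ[ℝ] EuclideanSpace ℝ (Fin n)) :
    ∃ X : Matrix (Fin n) (Fin n) ℝ, X.IsSymm ∧
      ∀ h, inner ℝ (Matrix.toEuclideanLin X h) h = inner ℝ (S h) h := by
  -- `S` need not be symmetric; its symmetric part has the same form.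
  refine ⟨Matrix.toEuclideanLin.symm ((1 / 2 : ℝ) • (S + LinearMap.adjoint S)), ?_, fun h => ?_⟩
  · have : (Matrix.toEuclideanLin.symm ((1 / 2 : ℝ) • (S + LinearMap.adjoint S))).IsHermitian := by
      rw [← Matrix.isSymmetric_toEuclideanLin_iff, LinearEquiv.apply_symm_apply]
      intro x y
      simp only [LinearMap.smul_apply, LinearMap.add_apply, inner_smul_left, inner_smul_right,
        inner_add_left, inner_add_right, LinearMap.adjoint_inner_left,
        LinearMap.adjoint_inner_right, conj_trivial]
      ring
    simpa [Matrix.IsHermitian, Matrix.IsSymm, Matrix.conjTranspose_eq_transpose_of_trivial]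
      using this
  · rw [LinearEquiv.apply_symm_apply]
    simp only [LinearMap.smul_apply, LinearMap.add_apply, inner_smul_left, inner_add_left,
      LinearMap.adjoint_inner_left, conj_trivial]
    rw [real_inner_comm h (S h)]
    ring

end Blocks

/-- A function which is homogeneous of degree two is nonnegative if it is so up to `o(|d|²)`. -/
theorem nonneg_of_eventually_nonneg_add_sq {V : Type*} [NormedAddCommGroup V] [NormedSpace ℝ V]
    {Q : V → ℝ} (hQ : ∀ (t : ℝ) d, Q (t • d) = t ^ 2 * Q d)
    (h : ∀ c > 0, ∀ᶠ d in 𝓝 0, 0 ≤ Q d + c * ‖d‖ ^ 2) (d : V) : 0 ≤ Q d := by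
  -- Apply the hypothesis to `t • d` with `t` small and divide by `t²`; then let `c` tend to `0`.
  have key : ∀ c > 0, 0 ≤ Q d + c * ‖d‖ ^ 2 := by
    intro c hc
    have hlim : Tendsto (fun t : ℝ => t • d) (𝓝[≠] 0) (𝓝 0) := by
      have : Continuous fun t : ℝ => t • d := by fun_prop
      simpa using (this.tendsto 0).mono_left (nhdsWithin_le_nhds (s := {0}ᶜ))
    obtain ⟨t, ht, ht0⟩ := ((hlim.eventually (h c hc)).and self_mem_nhdsWithin).exists
    rw [hQ, norm_smul, mul_pow, Real.norm_eq_abs, sq_abs] at ht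
    have ht2 : 0 < t ^ 2 := by
      have : t ≠ 0 := ht0
      positivity
    have : 0 ≤ t ^ 2 * (Q d + c * ‖d‖ ^ 2) := by linarith
    exact nonneg_of_mul_nonneg_right this ht2
  have hlim : Tendsto (fun c : ℝ => Q d + c * ‖d‖ ^ 2) (𝓝[>] 0) (𝓝 (Q d)) := by
    have : Continuous fun c : ℝ => Q d + c * ‖d‖ ^ 2 := by fun_prop
    simpa using (this.tendsto 0).mono_left (nhdsWithin_le_nhds (s := Set.Ioi 0))
  refine ge_of_tendsto hlim ?_
  filter_upwards [self_mem_nhdsWithin] with c hc using key c hc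

/-! ### Sup-convolutions and the transfer of superjets -/

section SupConvolution

variable {k : ℕ} {N : Fin k → ℕ}

/-- The quadratic part of the expansion of a sum of functions of separate variables is block
diagonal. -/
theorem inner_eq_sum_of_expansion {F : (i : Fin k) → EuclideanSpace ℝ (Fin (N i)) → ℝ}
    {x q : EuclideanSpace ℝ (Σ i, Fin (N i))}
    {T : EuclideanSpace ℝ (Σ i, Fin (N i)) →L[ℝ] EuclideanSpace ℝ (Σ i, Fin (N i))}
    (hT : ∀ c > 0, ∀ᶠ d in 𝓝 (0 : EuclideanSpace ℝ (Σ i, Fin (N i))),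
      |(∑ j, F j (block j (x + d))) - (∑ j, F j (block j x)) - inner ℝ q d
        - 1 / 2 * inner ℝ (T d) d| ≤ c * ‖d‖ ^ 2)
    (h : EuclideanSpace ℝ (Σ i, Fin (N i))) :
    inner ℝ (T h) h = ∑ i, inner ℝ (T (incl i (block i h))) (incl i (block i h)) := by
  -- Subtracting the expansions along the components `incl i (block i d)` from the expansion along
  -- `d` cancels values and linear parts, so the homogeneous function `D` is `o(‖d‖²)` and hence
  -- zero.
  set D : EuclideanSpace ℝ (Σ i, Fin (N i)) → ℝ := fun d =>
    inner ℝ (T d) d - ∑ i, inner ℝ (T (incl i (block i d))) (incl i (block i d)) with hD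
  have hDhom : ∀ (t : ℝ) d, D (t • d) = t ^ 2 * D d := by
    intro t d
    simp only [hD, block_smul, map_smul, inner_smul_left, inner_smul_right, conj_trivial,
      mul_sub, Finset.mul_sum]
    congr 1
    · ring
    · exact Finset.sum_congr rfl fun i _ => by ring
  have hev : ∀ c > 0, ∀ᶠ d in 𝓝 (0 : EuclideanSpace ℝ (Σ i, Fin (N i))),
      |D d| ≤ c * ‖d‖ ^ 2 := by
    intro c hc
    have h1 := hT (c / 4) (by positivity)
    have h2 : ∀ i, ∀ᶠ d in 𝓝 (0 : EuclideanSpace ℝ (Σ i, Fin (N i))),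
        |F i (block i x + block i d) - F i (block i x) - inner ℝ (block i q) (block i d)
          - 1 / 2 * inner ℝ (T (incl i (block i d))) (incl i (block i d))|
          ≤ c / 4 * ‖block i d‖ ^ 2 := by
      intro i
      have hlim : Tendsto (fun d : EuclideanSpace ℝ (Σ i, Fin (N i)) => incl i (block i d))
          (𝓝 0) (𝓝 0) := by
        rw [tendsto_zero_iff_norm_tendsto_zero]
        refine squeeze_zero (fun _ => norm_nonneg _)
          (fun d => (norm_incl i _).le.trans (norm_block_le d i)) ?_
        simpa using (continuous_norm (E := EuclideanSpace ℝ (Σ i, Fin (N i)))).tendsto 0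
      filter_upwards [hlim.eventually h1] with d hd
      rwa [sum_block_add_incl_sub, inner_incl, norm_incl] at hd
    filter_upwards [h1, eventually_all.2 h2] with d hd1 hd2
    have e1 : D d = 2 * (∑ i, (F i (block i x + block i d) - F i (block i x)
          - inner ℝ (block i q) (block i d)
          - 1 / 2 * inner ℝ (T (incl i (block i d))) (incl i (block i d))))
        - 2 * ((∑ j, F j (block j (x + d))) - (∑ j, F j (block j x)) - inner ℝ q d
        - 1 / 2 * inner ℝ (T d) d) := by
      simp only [hD, Finset.sum_sub_distrib, block_add, block_inner q d, ← Finset.mul_sum]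
      ring
    have h3 := (Finset.abs_sum_le_sum_abs _ _).trans
      (Finset.sum_le_sum fun i (_ : i ∈ Finset.univ) => hd2 i)
    rw [← Finset.mul_sum, ← block_norm_sq] at h3
    rw [e1, abs_le]
    rw [abs_le] at hd1 h3
    constructor <;> linarith
  have hp : 0 ≤ D h := nonneg_of_eventually_nonneg_add_sq hDhom (fun c hc => by
    filter_upwards [hev c hc] with d hd
    linarith [(abs_le.1 hd).1]) h
  have hn : 0 ≤ -D h := nonneg_of_eventually_nonneg_add_sq (Q := fun d => -D d)
    (fun t d => by simp only [hDhom]; ring) (fun c hc => by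
    filter_upwards [hev c hc] with d hd
    linarith [(abs_le.1 hd).2]) h
  have : D h = 0 := by linarith
  exact sub_eq_zero.1 this

/-- The maximum defining the sup-convolution of an upper semicontinuous function on a compact set is
attained. -/
theorem exists_sup_convolution_max {n : ℕ} {K : Set (EuclideanSpace ℝ (Fin n))} (hK : IsCompact K)
    (hne : K.Nonempty) {v : EuclideanSpace ℝ (Fin n) → ℝ} (hv : UpperSemicontinuousOn v K) (L : ℝ)
    (x : EuclideanSpace ℝ (Fin n)) :
    ∃ z ∈ K, ∀ z' ∈ K, v z' - L * ‖z' - x‖ ^ 2 ≤ v z - L * ‖z - x‖ ^ 2 := by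
  have hc : Continuous fun z : EuclideanSpace ℝ (Fin n) => -(L * ‖z - x‖ ^ 2) := by fun_prop
  have husc : UpperSemicontinuousOn (fun z => v z + -(L * ‖z - x‖ ^ 2)) K :=
    hv.add hc.continuousOn.upperSemicontinuousOn
  obtain ⟨z, hz, hmax⟩ := husc.exists_isMaxOn hne hK
  exact ⟨z, hz, fun z' hz' => by simpa [sub_eq_add_neg] using hmax hz'⟩

/-- Approximate form of the theorem on sums for a normalised problem on compact sets. -/
theorem exists_superjets_of_quadratic_bound
    {K : (i : Fin k) → Set (EuclideanSpace ℝ (Fin (N i)))} (hK : ∀ i, IsCompact (K i))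
    (hK0 : ∀ i, 0 ∈ K i) {v : (i : Fin k) → EuclideanSpace ℝ (Fin (N i)) → ℝ}
    (hv : ∀ i, UpperSemicontinuousOn (v i) (K i)) (hv0 : ∀ i, v i 0 = 0)
    {M : EuclideanSpace ℝ (Σ i, Fin (N i)) →L[ℝ] EuclideanSpace ℝ (Σ i, Fin (N i))}
    (hM : ∀ x y, inner ℝ (M x) y = inner ℝ (M y) x) {δ L : ℝ} (hδ : 0 < δ) (hL : 0 < L)
    (hbound : ∀ x, (∀ i, block i x ∈ K i) → ∀ y, ∑ i, v i (block i x)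
      ≤ 1 / 2 * inner ℝ (M y) y - δ * ‖y‖ ^ 2 + L * ‖x - y‖ ^ 2) {ρ : ℝ} (hρ : 0 < ρ) :
    ∃ (x z : EuclideanSpace ℝ (Σ i, Fin (N i))) (X : (i : Fin k) → Matrix (Fin (N i)) (Fin (N i)) ℝ),
      ‖x‖ ≤ ρ ∧ ‖(2 * L) • (z - x)‖ ≤ ρ ∧
      (∀ i, -(L * ‖block i x‖ ^ 2) ≤ v i (block i z)) ∧
      (∀ i, (block i ((2 * L) • (z - x)), X i) ∈ superjet (K i) (v i) (block i z)) ∧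
      ∀ h, -(2 * L * ‖h‖ ^ 2) ≤ inner ℝ (Matrix.toEuclideanLin (Matrix.blockDiagonal' X) h) h ∧
        inner ℝ (Matrix.toEuclideanLin (Matrix.blockDiagonal' X) h) h ≤ inner ℝ (M h) h := by
  choose! ζ hζK hζ using fun i => exists_sup_convolution_max (hK i) ⟨0, hK0 i⟩ (hv i) L
  set F : (i : Fin k) → EuclideanSpace ℝ (Fin (N i)) → ℝ := fun i y =>
    v i (ζ i y) - L * ‖ζ i y - y‖ ^ 2 with hF
  set f : EuclideanSpace ℝ (Σ i, Fin (N i)) → ℝ := fun y => ∑ i, F i (block i y) with hf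
  set Z : EuclideanSpace ℝ (Σ i, Fin (N i)) → EuclideanSpace ℝ (Σ i, Fin (N i)) := fun y =>
    glue (fun i => ζ i (block i y)) with hZ
  -- The maximiser for `x` is a competitor at `y`, which gives a touching paraboloid with slope
  -- `2L(Z x - x)`.
  have hlow : ∀ x y, f x + inner ℝ ((2 * L) • (Z x - x)) (y - x) - L * ‖y - x‖ ^ 2 ≤ f y := by
    intro x y
    rw [block_inner, block_norm_sq, Finset.mul_sum, ← Finset.sum_add_distrib,
      ← Finset.sum_sub_distrib]
    refine Finset.sum_le_sum fun i _ => ?_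
    have h1 := hζ i (block i y) (ζ i (block i x)) (hζK i _)
    refine le_trans (le_of_eq ?_) h1
    have e1 : ζ i (block i x) - block i y = (ζ i (block i x) - block i x)
      - (block i y - block i x) := by abel
    rw [e1, norm_sub_sq_real, block_smul, block_sub, block_sub, inner_smul_left]
    simp only [hF, hZ, block_glue, conj_trivial]
    ring
  have hup : ∀ y, f y ≤ 1 / 2 * inner ℝ (M y) y - δ * ‖y‖ ^ 2 := by
    intro y
    have h1 := hbound (Z y) (fun i => hζK i (block i y)) y
    have h2 : f y = ∑ i, v i (block i (Z y)) - L * ‖Z y - y‖ ^ 2 := by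
      rw [block_norm_sq, Finset.mul_sum, ← Finset.sum_sub_distrib]
      rfl
    linarith
  have hF0 : ∀ i y, -(L * ‖y‖ ^ 2) ≤ F i y := by
    intro i y
    have h1 := hζ i y 0 (hK0 i)
    rw [hv0, zero_sub, zero_sub, norm_neg] at h1
    exact h1
  have h0 : f 0 = 0 := by
    refine le_antisymm (by simpa using hup 0) (Finset.sum_nonneg fun i _ => ?_)
    simpa [block_zero] using hF0 i (block i 0)
  obtain ⟨x, q, T, hxρ, hqρ, hqlow, hqup, hexp⟩ :=
    exists_second_order_point (fun x => ⟨_, hlow x⟩) hM hδ h0 hup hρ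
  have hq : q = (2 * L) • (Z x - x) := by
    refine sub_eq_zero.1 (eq_zero_of_inner_ge_neg_sq (C := L + 1 / 2 * ‖M‖) fun h => ?_)
    have h1 := hqup (x + h)
    have h2 := hlow x (x + h)
    rw [add_sub_cancel_left] at h1 h2
    have h3 : inner ℝ (M h) h ≤ ‖M‖ * ‖h‖ * ‖h‖ :=
      (real_inner_le_norm _ _).trans (mul_le_mul_of_nonneg_right (M.le_opNorm h) (norm_nonneg h))
    rw [inner_sub_left]
    nlinarith
  have hexp' : ∀ c > 0, ∀ᶠ d in 𝓝 (0 : EuclideanSpace ℝ (Σ i, Fin (N i))),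
      |f (x + d) - f x - inner ℝ q d - 1 / 2 * inner ℝ (T d) d| ≤ c * ‖d‖ ^ 2 := by
    intro c hc
    have hlim : Tendsto (fun d => x + d) (𝓝 0) (𝓝 x) := by
      have : Continuous fun d => x + d := by fun_prop
      simpa using this.tendsto 0
    filter_upwards [hlim.eventually (hexp c hc)] with d hd
    rwa [add_sub_cancel_left] at hd
  -- `X i` is the symmetric part of the compression of `T` to the `i`-th factor.
  choose X hXsymm hX using fun i => exists_isSymm_inner_toEuclideanLin
    (LinearMap.adjoint (incl (N := N) i) ∘ₗ T.toLinearMap ∘ₗ incl i)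
  have hXi : ∀ i h, inner ℝ (Matrix.toEuclideanLin (X i) h) h
      = inner ℝ (T (incl i h)) (incl i h) := by
    intro i h
    rw [hX, LinearMap.comp_apply, LinearMap.adjoint_inner_left]
    rfl
  have hXT : ∀ h, inner ℝ (Matrix.toEuclideanLin (Matrix.blockDiagonal' X) h) h
      = inner ℝ (T h) h := by
    intro h
    rw [inner_toEuclideanLin_blockDiagonal', inner_eq_sum_of_expansion hexp' h]
    exact Finset.sum_congr rfl fun i _ => hXi i _
  refine ⟨x, Z x, X, hxρ, hq ▸ hqρ, fun i => ?_, fun i => ?_, fun h => ?_⟩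
  · have h1 := hF0 i (block i x)
    have h2 : 0 ≤ L * ‖ζ i (block i x) - block i x‖ ^ 2 := by positivity
    simp only [hF] at h1
    simp only [hZ, block_glue]
    linarith
  · rw [← hq]
    refine ⟨hζK i (block i x), hXsymm i, fun c hc => ?_⟩
    set z := block i (Z x) with hz
    have hlim : Tendsto (fun z' => incl i (z' - z)) (𝓝[K i] z) (𝓝 0) := by
      refine Tendsto.mono_left ?_ nhdsWithin_le_nhds
      rw [tendsto_zero_iff_norm_tendsto_zero]
      simp only [norm_incl]
      have : Continuous fun z' => ‖z' - z‖ := by fun_prop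
      simpa using this.tendsto z
    filter_upwards [hlim.eventually (hexp' c hc), self_mem_nhdsWithin] with z' hz' hz'K
    have h1 := (abs_le.1 hz').2
    have h2 := sum_block_add_incl_sub F x i (z' - z)
    rw [norm_incl, inner_incl, ← hXi] at h1
    -- Shifting the base point by `z' - z` keeps the displacement to the competitor `z'` equal to `z
    -- - block i x`. The penalties cancel, and the upper expansion of `F i` passes to `v i` at `z`.
    have h3 := hζ i (block i x + (z' - z)) z' hz'K
    have e1 : z' - (block i x + (z' - z)) = z - block i x := by abel
    rw [e1] at h3
    have e2 : F i (block i x) = v i z - L * ‖z - block i x‖ ^ 2 := rfl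
    have e3 : f (x + incl i (z' - z)) - f x = F i (block i x + (z' - z)) - F i (block i x) := h2
    have e4 : v i z' - L * ‖z - block i x‖ ^ 2 ≤ F i (block i x + (z' - z)) := h3
    linarith
  · rw [hXT]
    have hhom : ∀ (S : EuclideanSpace ℝ (Σ i, Fin (N i)) →L[ℝ] EuclideanSpace ℝ (Σ i, Fin (N i)))
        (t : ℝ) d, inner ℝ (S (t • d)) (t • d) = t ^ 2 * inner ℝ (S d) d := by
      intro S t d
      simp only [map_smul, inner_smul_left, inner_smul_right, conj_trivial]
      ring
    constructor
    · have := nonneg_of_eventually_nonneg_add_sq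
        (Q := fun d => inner ℝ (T d) d + 2 * L * ‖d‖ ^ 2)
        (fun t d => by
          simp only [hhom, norm_smul, mul_pow, Real.norm_eq_abs, sq_abs]; ring)
        (fun c hc => by
          filter_upwards [hexp' (c / 2) (by positivity)] with d hd
          have h1 := hqlow (x + d)
          rw [add_sub_cancel_left] at h1
          linarith [(abs_le.1 hd).2]) h
      linarith
    · have := nonneg_of_eventually_nonneg_add_sq
        (Q := fun d => inner ℝ (M d) d - inner ℝ (T d) d)
        (fun t d => by simp only [hhom]; ring)
        (fun c hc => by
          filter_upwards [hexp' (c / 2) (by positivity)] with d hd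
          have h1 := hqup (x + d)
          rw [add_sub_cancel_left] at h1
          linarith [(abs_le.1 hd).1]) h
      linarith

end SupConvolution

/-! ### Taylor expansion of the test function -/

section Taylor

/-- Second-order Taylor expansion with Peano remainder. -/
theorem eventually_abs_taylor_two_le {V : Type*} [NormedAddCommGroup V] [NormedSpace ℝ V]
    {φ : V → ℝ} {x : V} (hφ : ContDiffAt ℝ 2 φ x) {c : ℝ} (hc : 0 < c) :
    ∀ᶠ y in 𝓝 x, |φ y - φ x - fderiv ℝ φ x (y - x)
      - 1 / 2 * fderiv ℝ (fderiv ℝ φ) x (y - x) (y - x)| ≤ c * ‖y - x‖ ^ 2 := by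
  set b := fderiv ℝ (fderiv ℝ φ) x with hb
  have hsymm : ∀ v w, b v w = b w v := fun v w =>
    (hφ.isSymmSndFDerivAt (by simp)).eq v w
  have hd1 : ∀ᶠ y in 𝓝 x, DifferentiableAt ℝ φ y :=
    (hφ.eventually (by simp)).mono fun y hy => hy.differentiableAt (by simp)
  have hd2 : HasFDerivAt (fderiv ℝ φ) b x :=
    ((hφ.fderiv_right (m := 1) (by norm_num)).differentiableAt (by simp)).hasFDerivAt
  have hev := hd1.and ((hasFDerivAt_iff_isLittleO.1 hd2).def hc)
  obtain ⟨r, hr, hball⟩ := Metric.mem_nhds_iff.1 hev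
  filter_upwards [Metric.ball_mem_nhds x hr] with y hy
  -- By symmetry of `b` the derivative of `R` at `w` is the first-order remainder of `fderiv ℝ φ`,
  -- and the mean value inequality on the ball applies.
  set R : V → ℝ := fun y => φ y - φ x - fderiv ℝ φ x (y - x) - 1 / 2 * b (y - x) (y - x) with hR
  have hRd : ∀ w ∈ Metric.closedBall x ‖y - x‖,
      HasFDerivWithinAt R (fderiv ℝ φ w - fderiv ℝ φ x - b (w - x))
        (Metric.closedBall x ‖y - x‖) w := by
    intro w hw
    have hwr : w ∈ Metric.ball x r := by
      rw [mem_ball_iff_norm] at hy ⊢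
      rw [mem_closedBall_iff_norm] at hw
      exact hw.trans_lt hy
    have hid : HasFDerivAt (fun y : V => y - x) (ContinuousLinearMap.id ℝ V) w :=
      (hasFDerivAt_id w).sub_const x
    have h1 : HasFDerivAt (fun y => b (y - x)) b w := by
      have := b.hasFDerivAt.comp w hid
      rwa [ContinuousLinearMap.comp_id] at this
    have h2 : HasFDerivAt (fun y => fderiv ℝ φ x (y - x)) (fderiv ℝ φ x) w := by
      have := (fderiv ℝ φ x).hasFDerivAt.comp w hid
      rwa [ContinuousLinearMap.comp_id] at this
    have h3 := (((hball hwr).1.hasFDerivAt.sub_const (φ x)).sub h2).sub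
      ((h1.clm_apply hid).const_mul (1 / 2))
    refine HasFDerivAt.hasFDerivWithinAt ?_
    refine h3.congr_fderiv (ContinuousLinearMap.ext fun v => ?_)
    simp only [one_div, map_sub, ContinuousLinearMap.comp_id, sub_apply, smul_apply, add_apply,
      ContinuousLinearMap.flip_apply, smul_eq_mul, hsymm v w, hsymm v x]
    ring
  have hbd : ∀ w ∈ Metric.closedBall x ‖y - x‖,
      ‖fderiv ℝ φ w - fderiv ℝ φ x - b (w - x)‖ ≤ c * ‖y - x‖ := by
    intro w hw
    have hwr : w ∈ Metric.ball x r := by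
      rw [mem_ball_iff_norm] at hy ⊢
      rw [mem_closedBall_iff_norm] at hw
      exact hw.trans_lt hy
    rw [mem_closedBall_iff_norm] at hw
    exact (hball hwr).2.trans (by gcongr)
  have hfin := (convex_closedBall x ‖y - x‖).norm_image_sub_le_of_norm_hasFDerivWithin_le hRd hbd
    (Metric.mem_closedBall_self (norm_nonneg _)) (y := y) (by rw [mem_closedBall_iff_norm])
  have hRx : R x = 0 := by simp [hR]
  rw [hRx, sub_zero, Real.norm_eq_abs] at hfin
  refine hfin.trans (le_of_eq ?_)
  ring

end Taylor

/-! ### Symmetric matrices and their quadratic forms -/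

section Matrices

variable {ι : Type*} [Fintype ι] [DecidableEq ι]

theorem inner_toEuclideanLin_self (X : Matrix ι ι ℝ) (h : EuclideanSpace ℝ ι) :
    inner ℝ (Matrix.toEuclideanLin X h) h = ∑ a, (∑ b, X a b * h b) * h a := by
  simp [PiLp.inner_apply, Matrix.toLpLin_apply, Matrix.mulVec, dotProduct, mul_comm]

theorem inner_toEuclideanLin_comm {A : Matrix ι ι ℝ} (hA : A.IsSymm) (x y : EuclideanSpace ℝ ι) :
    inner ℝ (Matrix.toEuclideanLin A x) y = inner ℝ (Matrix.toEuclideanLin A y) x := by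
  have h : (Matrix.toEuclideanLin A).IsSymmetric := by
    rw [Matrix.isSymmetric_toEuclideanLin_iff]
    simpa [Matrix.IsHermitian, Matrix.conjTranspose_eq_transpose_of_trivial] using hA.eq
  rw [h x y, real_inner_comm]

theorem posSemidef_of_inner_nonneg {A : Matrix ι ι ℝ} (hA : A.IsSymm)
    (h : ∀ x, 0 ≤ inner ℝ (Matrix.toEuclideanLin A x) x) : A.PosSemidef := by
  refine Matrix.PosSemidef.of_dotProduct_mulVec_nonneg ?_ fun x => ?_
  · simpa [Matrix.IsHermitian, Matrix.conjTranspose_eq_transpose_of_trivial] using hA.eq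
  · have := h (WithLp.toLp 2 x)
    simpa [PiLp.inner_apply, Matrix.toLpLin_apply, dotProduct, mul_comm] using this

theorem inner_toEuclideanLin_sq {A : Matrix ι ι ℝ} (hA : A.IsSymm) (x : EuclideanSpace ℝ ι) :
    inner ℝ (Matrix.toEuclideanLin (A ^ 2) x) x = ‖Matrix.toEuclideanLin A x‖ ^ 2 := by
  have : Matrix.toEuclideanLin (A ^ 2) x
      = Matrix.toEuclideanLin A (Matrix.toEuclideanLin A x) := by
    simp [Matrix.toLpLin_apply, pow_two]
  rw [this, inner_toEuclideanLin_comm hA, real_inner_self_eq_norm_sq]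

/-- Every eigenvalue is bounded by `symmNorm`. -/
theorem abs_le_symmNorm {A : Matrix ι ι ℝ} {μ : ℝ}
    (h : Module.End.HasEigenvalue (Matrix.toLin' A) μ) : |μ| ≤ symmNorm A := by
  refine le_csSup ?_ ⟨μ, h, rfl⟩
  have hfin : {μ : ℝ | Module.End.HasEigenvalue (Matrix.toLin' A) μ}.Finite :=
    Module.End.finite_hasEigenvalue _
  have : {r | ∃ μ : ℝ, Module.End.HasEigenvalue (Matrix.toLin' A) μ ∧ r = |μ|}
      = (fun μ : ℝ => |μ|) '' {μ : ℝ | Module.End.HasEigenvalue (Matrix.toLin' A) μ} := by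
    ext r
    simp [eq_comm]
  rw [this]
  exact (hfin.image _).bddAbove

/-- If `ν` is an eigenvalue of `symmNorm A • 1 - A`, then `symmNorm A - ν` is one of `A`, hence at
most `symmNorm A`; so `ν ≥ 0`. -/
theorem inner_toEuclideanLin_le_symmNorm {A : Matrix ι ι ℝ} (hA : A.IsSymm)
    (x : EuclideanSpace ℝ ι) :
    inner ℝ (Matrix.toEuclideanLin A x) x ≤ symmNorm A * ‖x‖ ^ 2 := by
  have hB : (symmNorm A • (1 : Matrix ι ι ℝ) - A).IsHermitian := by
    simp only [Matrix.IsHermitian, Matrix.conjTranspose_eq_transpose_of_trivial,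
      Matrix.transpose_sub, Matrix.transpose_smul, Matrix.transpose_one, hA.eq]
  have hpos : (symmNorm A • (1 : Matrix ι ι ℝ) - A).PosSemidef := by
    rw [hB.posSemidef_iff_eigenvalues_nonneg]
    intro j
    have h1 := hB.mulVec_eigenvectorBasis j
    set v := (hB.eigenvectorBasis j) with hv
    have hv0 : v ≠ 0 := hB.eigenvectorBasis.orthonormal.ne_zero j
    have h2 : Module.End.HasEigenvalue (Matrix.toLin' A) (symmNorm A - hB.eigenvalues j) := by
      refine Module.End.hasEigenvalue_of_hasEigenvector (x := v.ofLp) ⟨?_, ?_⟩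
      · rw [Module.End.mem_eigenspace_iff, Matrix.toLin'_apply]
        rw [Matrix.sub_mulVec, Matrix.smul_mulVec, Matrix.one_mulVec] at h1
        rw [sub_smul, ← h1]
        abel
      · intro h0
        exact hv0 (by ext a; simpa using congrFun h0 a)
    have h3 := (le_abs_self _).trans (abs_le_symmNorm h2)
    simp only [Pi.zero_apply]
    linarith
  rw [← Matrix.isPositive_toEuclideanLin_iff] at hpos
  have := hpos.inner_nonneg_left x
  simp only [map_sub, map_smul, LinearMap.sub_apply, LinearMap.smul_apply, inner_sub_left,
    inner_smul_left, Matrix.toLpLin_one, LinearMap.id_apply, real_inner_self_eq_norm_sq,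
    conj_trivial] at this
  linarith

theorem symmNorm_nonneg (A : Matrix ι ι ℝ) : 0 ≤ symmNorm A :=
  Real.sSup_nonneg fun _ ⟨μ, _, hr⟩ => hr ▸ abs_nonneg μ

/-- The matrix inequality which turns a quadratic upper bound into one for sup-convolutions. -/
theorem inner_toEuclideanLin_le_add_smul_sq {A : Matrix ι ι ℝ} (hA : A.IsSymm) {ε : ℝ} (hε : 0 < ε)
    (x y : EuclideanSpace ℝ ι) :
    inner ℝ (Matrix.toEuclideanLin A x) x ≤ inner ℝ (Matrix.toEuclideanLin (A + ε • A ^ 2) y) y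
      + (1 / ε + symmNorm A) * ‖x - y‖ ^ 2 := by
  -- Expand around `y`: Young's inequality splits the cross term `2⟨Ay,d⟩` into `ε|Ay|²` and
  -- `|d|²/ε`, and the form at `d` is at most `symmNorm A * |d|²`.
  obtain ⟨d, rfl⟩ : ∃ d, x = y + d := ⟨x - y, by abel⟩
  rw [add_sub_cancel_left]
  have h1 := inner_toEuclideanLin_le_symmNorm hA d
  have h2 : 2 * inner ℝ (Matrix.toEuclideanLin A y) d
      ≤ ε * ‖Matrix.toEuclideanLin A y‖ ^ 2 + 1 / ε * ‖d‖ ^ 2 := by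
    have h3 := real_inner_le_norm (Matrix.toEuclideanLin A y) d
    have h4 : 0 ≤ (ε * ‖Matrix.toEuclideanLin A y‖ - ‖d‖) ^ 2 * (1 / ε) := by positivity
    have h5 : (ε * ‖Matrix.toEuclideanLin A y‖ - ‖d‖) ^ 2 * (1 / ε)
        = ε * ‖Matrix.toEuclideanLin A y‖ ^ 2 + 1 / ε * ‖d‖ ^ 2
          - 2 * (‖Matrix.toEuclideanLin A y‖ * ‖d‖) := by
      field_simp
      ring
    linarith
  have h6 := inner_toEuclideanLin_comm hA y d
  simp only [map_add, map_smul, LinearMap.add_apply, LinearMap.smul_apply, inner_add_left,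
    inner_add_right, inner_smul_left, conj_trivial, inner_toEuclideanLin_sq hA]
  linarith

theorem inner_toEuclideanLin_hessianMatrix (φ : EuclideanSpace ℝ ι → ℝ) (x h : EuclideanSpace ℝ ι) :
    inner ℝ (Matrix.toEuclideanLin (hessianMatrix φ x) h) h
      = fderiv ℝ (fderiv ℝ φ) x h h := by
  have hh : h = ∑ a, h a • EuclideanSpace.single a (1 : ℝ) := by
    ext j
    simp [Finset.sum_apply, Pi.single_apply]
  rw [inner_toEuclideanLin_self]
  conv_rhs => rw [hh]
  simp only [map_sum, map_smul, sum_apply, smul_apply,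
    smul_eq_mul, hessianMatrix, Matrix.of_apply, Finset.sum_mul, Finset.mul_sum]
  rw [Finset.sum_comm]
  exact Finset.sum_congr rfl fun a _ => Finset.sum_congr rfl fun b _ => by ring

theorem hessianMatrix_isSymm {φ : EuclideanSpace ℝ ι → ℝ} {x : EuclideanSpace ℝ ι}
    (hφ : ContDiffAt ℝ 2 φ x) : (hessianMatrix φ x).IsSymm := by
  ext a b
  exact (hφ.isSymmSndFDerivAt (by simp)).eq _ _

/-- Entries of a symmetric matrix are controlled by its quadratic form. -/
theorem abs_entry_le_of_inner_le {X : Matrix ι ι ℝ} (hX : X.IsSymm) {C : ℝ}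
    (h : ∀ x, |inner ℝ (Matrix.toEuclideanLin X x) x| ≤ C * ‖x‖ ^ 2) (a b : ι) :
    |X a b| ≤ C := by
  set e : EuclideanSpace ℝ ι := EuclideanSpace.single a 1 with he
  set g : EuclideanSpace ℝ ι := EuclideanSpace.single b 1 with hg
  -- Polarisation: `4 X a b` is the difference of the form at `e + g` and `e - g`, whose squared
  -- norms add up to `4`.
  have h1 := abs_le.1 (h (e + g))
  have h2 := abs_le.1 (h (e - g))
  have hcomm := inner_toEuclideanLin_comm hX e g
  have hab : inner ℝ (Matrix.toEuclideanLin X g) e = X a b := by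
    simp [he, hg, Matrix.toLpLin_apply, EuclideanSpace.inner_single_right]
  have hpar := parallelogram_law_with_norm ℝ e g
  have hen : ‖e‖ = 1 := by simp [he]
  have hgn : ‖g‖ = 1 := by simp [hg]
  rw [hen, hgn] at hpar
  simp only [map_add, map_sub, inner_add_left, inner_add_right, inner_sub_left, inner_sub_right]
    at h1 h2
  have h3 : C * ‖e + g‖ ^ 2 + C * ‖e - g‖ ^ 2 = 4 * C := by
    rw [← mul_add]; nlinarith
  rw [abs_le]
  constructor <;> linarith [h1.1, h1.2, h2.1, h2.2]

end Matrices

/-! ### Reduction to compact sets and translation of superjets -/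

section Localization

variable {n : ℕ} {O : Set (EuclideanSpace ℝ (Fin n))}

/-- A point of a locally compact set has arbitrarily small compact neighbourhoods in it. -/
theorem exists_isCompact_nhds (hO : LocallyCompactSpace O) {x : EuclideanSpace ℝ (Fin n)}
    (hx : x ∈ O) {r : ℝ} (hr : 0 < r) :
    ∃ K : Set (EuclideanSpace ℝ (Fin n)), IsCompact K ∧ K ⊆ O ∧ (∀ y ∈ K, ‖y - x‖ ≤ r) ∧
      ∃ s > 0, ∀ y ∈ O, ‖y - x‖ < s → y ∈ K := by
  have hmem : (Subtype.val ⁻¹' Metric.closedBall x r : Set O) ∈ 𝓝 (⟨x, hx⟩ : O) :=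
    continuous_subtype_val.continuousAt (Metric.closedBall_mem_nhds x hr)
  obtain ⟨S, hS, hSsub, hScomp⟩ := local_compact_nhds hmem
  refine ⟨Subtype.val '' S, hScomp.image continuous_subtype_val, ?_, ?_, ?_⟩
  · rintro _ ⟨y, _, rfl⟩
    exact y.2
  · rintro _ ⟨y, hy, rfl⟩
    exact mem_closedBall_iff_norm.1 (hSsub hy)
  · obtain ⟨s, hs, hsub⟩ := Metric.mem_nhds_iff.1 hS
    refine ⟨s, hs, fun y hyO hy => ⟨⟨y, hyO⟩, hsub ?_, rfl⟩⟩
    rw [Metric.mem_ball, Subtype.dist_eq, dist_eq_norm]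
    exact hy

/-- Superjets of a translate of `u` minus an affine function, taken relative to a neighbourhood. -/
theorem superjet_of_translate {K : Set (EuclideanSpace ℝ (Fin n))} (hKO : K ⊆ O)
    {u : EuclideanSpace ℝ (Fin n) → ℝ} {a g d q : EuclideanSpace ℝ (Fin n)}
    {X : Matrix (Fin n) (Fin n) ℝ} (hK : K ∈ 𝓝[O] (a + d))
    (h : (q, X) ∈ superjet {e | a + e ∈ K} (fun e => u (a + e) - u a - inner ℝ g e) d) :
    (q + g, X) ∈ superjet O u (a + d) := by
  obtain ⟨hd, hX, hev⟩ := h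
  refine ⟨hKO hd, hX, fun c hc => ?_⟩
  have hlim : Tendsto (fun y => y - a) (𝓝[O] (a + d)) (𝓝[{e | a + e ∈ K}] d) := by
    refine tendsto_nhdsWithin_iff.2 ⟨Tendsto.mono_left ?_ nhdsWithin_le_nhds, ?_⟩
    · have : Continuous fun y : EuclideanSpace ℝ (Fin n) => y - a := by fun_prop
      simpa using this.tendsto (a + d)
    · filter_upwards [hK] with y hy
      simpa using hy
  filter_upwards [hlim.eventually (hev c hc)] with y hy
  have e1 : y - a - d = y - (a + d) := by abel
  have e2 : inner ℝ g (y - a) = inner ℝ g d + inner ℝ g (y - (a + d)) := by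
    rw [← inner_add_right]; congr 1; abel
  simp only [e1, add_sub_cancel, e2] at hy
  rw [inner_add_left]
  linarith

end Localization

/-! ### Approximate superjets and passage to the limit -/

section TheoremOnSums

variable {k : ℕ} {N : Fin k → ℕ}

/-- Approximate form of the theorem on sums. -/
theorem exists_approximate_superjets
    {O : (i : Fin k) → Set (EuclideanSpace ℝ (Fin (N i)))}
    (hO : ∀ i, LocallyCompactSpace (O i))
    {u : (i : Fin k) → EuclideanSpace ℝ (Fin (N i)) → ℝ}
    (hu : ∀ i, UpperSemicontinuousOn (u i) (O i))
    {φ : EuclideanSpace ℝ (Σ i, Fin (N i)) → ℝ} {xhat : EuclideanSpace ℝ (Σ i, Fin (N i))}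
    (hφ : ContDiffAt ℝ 2 φ xhat) (hxhat : xhat ∈ blockProd O)
    (hmax : IsLocalMaxOn (fun x => (∑ i, u i (block i x)) - φ x) (blockProd O) xhat)
    {ε : ℝ} (hε : 0 < ε) {η : ℝ} (hη : 0 < η) :
    ∃ (z p : EuclideanSpace ℝ (Σ i, Fin (N i))) (X : (i : Fin k) → Matrix (Fin (N i)) (Fin (N i)) ℝ),
      ‖z - xhat‖ ≤ η ∧ ‖p - gradient φ xhat‖ ≤ η ∧
      (∀ i, u i (block i xhat) - η ≤ u i (block i z)) ∧
      (∀ i, (block i p, X i) ∈ superjet (O i) (u i) (block i z)) ∧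
      ∀ h, -((1 / ε + symmNorm (hessianMatrix φ xhat) + η) * ‖h‖ ^ 2)
          ≤ inner ℝ (Matrix.toEuclideanLin (Matrix.blockDiagonal' X) h) h ∧
        inner ℝ (Matrix.toEuclideanLin (Matrix.blockDiagonal' X) h) h
          ≤ inner ℝ (Matrix.toEuclideanLin
            (hessianMatrix φ xhat + ε • hessianMatrix φ xhat ^ 2) h) h + η * ‖h‖ ^ 2 := by
  set A := hessianMatrix φ xhat with hA
  have hAsymm : A.IsSymm := hessianMatrix_isSymm hφ
  have hBsymm : (A + ε • A ^ 2).IsSymm := hAsymm.add ((hAsymm.pow 2).smul ε)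
  set B := A + ε • A ^ 2 with hB
  set g := gradient φ xhat with hg
  set θ := η / 4 with hθ
  have hθpos : 0 < θ := by positivity
  set L := (1 / ε + symmNorm A) / 2 + θ with hL
  have hAn := symmNorm_nonneg A
  have hLpos : 0 < L := by positivity
  -- the local maximum and the Taylor expansion hold on a ball
  have hev : ∀ᶠ y in 𝓝 xhat, y ∈ blockProd O → (∑ i, u i (block i y)) - ∑ i, u i (block i xhat)
      - inner ℝ g (y - xhat) ≤ 1 / 2 * inner ℝ (Matrix.toEuclideanLin A (y - xhat)) (y - xhat)
        + θ / 2 * ‖y - xhat‖ ^ 2 := by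
    have h1 := eventually_nhdsWithin_iff.1 hmax
    have h2 := eventually_abs_taylor_two_le hφ (c := θ / 2) (by positivity)
    filter_upwards [h1, h2] with y hy1 hy2 hyO
    have h3 := hy1 hyO
    have h4 := (abs_le.1 hy2).2
    have h5 : fderiv ℝ φ xhat (y - xhat) = inner ℝ g (y - xhat) := by
      rw [hg, gradient, InnerProductSpace.toDual_symm_apply]
    rw [h5, ← inner_toEuclideanLin_hessianMatrix, ← hA] at h4
    linarith
  obtain ⟨R, hR, hball⟩ := Metric.mem_nhds_iff.1 hev
  have hk : (0 : ℝ) < k + 1 := by positivity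
  -- With this radius `‖x‖² ≤ kR²/(k + 1)² < R²`, also when `k = 0`.
  choose K hKc hKO hKr s hs hKs using fun i =>
    exists_isCompact_nhds (hO i) (hxhat i) (r := R / (k + 1)) (by positivity)
  set v : (i : Fin k) → EuclideanSpace ℝ (Fin (N i)) → ℝ := fun i e =>
    u i (block i xhat + e) - u i (block i xhat) - inner ℝ (block i g) e with hv
  have hKnorm : ∀ x : EuclideanSpace ℝ (Σ i, Fin (N i)),
      (∀ i, block i x ∈ {e | block i xhat + e ∈ K i}) → ‖x‖ < R := by
    intro x hx
    have h1 : ‖x‖ ^ 2 ≤ k * (R / (k + 1)) ^ 2 := by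
      rw [block_norm_sq]
      refine (Finset.sum_le_card_nsmul _ _ ((R / (k + 1)) ^ 2) fun i _ => ?_).trans (by simp)
      have := hKr i _ (hx i)
      rw [add_sub_cancel_left] at this
      gcongr
    refine lt_of_pow_lt_pow_left₀ 2 hR.le (h1.trans_lt ?_)
    rw [div_pow, mul_div_assoc', div_lt_iff₀ (by positivity)]
    have : 0 < R ^ 2 := by positivity
    have hk0 : (0 : ℝ) ≤ k := Nat.cast_nonneg k
    nlinarith [mul_nonneg this.le hk0, mul_nonneg this.le (sq_nonneg (k : ℝ))]
  -- Half of `4θ` is `2θ`: one `θ` absorbs the Taylor error in `y`, the other leaves the strict gap.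
  -- The Taylor error in `x - y` is the `θ` in `L`. Since `4θ = η`, `M` is `B + η`.
  set M : EuclideanSpace ℝ (Σ i, Fin (N i)) →L[ℝ] EuclideanSpace ℝ (Σ i, Fin (N i)) :=
    LinearMap.toContinuousLinearMap (Matrix.toEuclideanLin B)
      + (4 * θ) • ContinuousLinearMap.id ℝ _ with hM
  have hMin : ∀ x y, inner ℝ (M x) y = inner ℝ (Matrix.toEuclideanLin B x) y
      + 4 * θ * inner ℝ x y := by
    intro x y
    simp only [hM, add_apply, smul_apply, ContinuousLinearMap.id_apply, inner_add_left,
      inner_smul_left, conj_trivial, LinearMap.coe_toContinuousLinearMap']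
  have hMsymm : ∀ x y, inner ℝ (M x) y = inner ℝ (M y) x := by
    intro x y
    rw [hMin, hMin, inner_toEuclideanLin_comm hBsymm, real_inner_comm x y]
  have hbound : ∀ x, (∀ i, block i x ∈ {e | block i xhat + e ∈ K i}) → ∀ y,
      ∑ i, v i (block i x) ≤ 1 / 2 * inner ℝ (M y) y - θ * ‖y‖ ^ 2 + L * ‖x - y‖ ^ 2 := by
    intro x hx y
    have hmem : xhat + x ∈ Metric.ball xhat R := by
      rw [mem_ball_iff_norm, add_sub_cancel_left]
      exact hKnorm x hx
    have h1 := hball hmem (fun i => hKO i (hx i))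
    rw [add_sub_cancel_left] at h1
    have h2 : ∑ i, v i (block i x) = (∑ i, u i (block i (xhat + x)))
        - ∑ i, u i (block i xhat) - inner ℝ g x := by
      rw [block_inner g x, ← Finset.sum_sub_distrib, ← Finset.sum_sub_distrib]
      rfl
    have h3 := inner_toEuclideanLin_le_add_smul_sq hAsymm hε x y
    have h4 : ‖x‖ ^ 2 ≤ 2 * (‖y‖ ^ 2 + ‖x - y‖ ^ 2) := by
      have := norm_add_le y (x - y)
      rw [add_sub_cancel] at this
      nlinarith [sq_nonneg (‖y‖ - ‖x - y‖), norm_nonneg x]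
    have h5 := mul_le_mul_of_nonneg_left h4 (half_pos hθpos).le
    rw [hMin, real_inner_self_eq_norm_sq, h2, hL]
    linarith
  -- smallness of the perturbation
  obtain ⟨σ, hσ, hση, hσs, hσg⟩ : ∃ σ > 0, σ ≤ η ∧ (∀ i, σ < s i) ∧ ‖g‖ * σ ≤ η / 2 := by
    have h1 : ∀ᶠ σ in 𝓝[>] (0 : ℝ), σ < η := nhdsWithin_le_nhds (gt_mem_nhds hη)
    have h2 : ∀ᶠ σ in 𝓝[>] (0 : ℝ), ∀ i, σ < s i :=
      eventually_all.2 fun i => nhdsWithin_le_nhds (gt_mem_nhds (hs i))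
    have h3 : ∀ᶠ σ in 𝓝[>] (0 : ℝ), ‖g‖ * σ < η / 2 := by
      have : Tendsto (fun σ : ℝ => ‖g‖ * σ) (𝓝[>] 0) (𝓝 0) := by
        have hc : Continuous fun σ : ℝ => ‖g‖ * σ := by fun_prop
        simpa using (hc.tendsto 0).mono_left (nhdsWithin_le_nhds (s := Set.Ioi 0))
      exact this.eventually (gt_mem_nhds (half_pos hη))
    obtain ⟨σ, h1, h2, h3, h4⟩ := (h1.and (h2.and (h3.and self_mem_nhdsWithin))).exists
    exact ⟨σ, h4, h1.le, h2, h3.le⟩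
  -- `ρ + ρ/(2L)` bounds `‖x‖ + ‖z - x‖ ≥ ‖z‖`; the loss in the values of `u i` is at most `Lρ² +
  -- ‖g‖σ ≤ η`. The condition `σ < s i` makes `K i` a neighbourhood relative to `O i` of the point
  -- reached.
  obtain ⟨ρ, hρ, hρη, hρσ, hρL⟩ : ∃ ρ > 0, ρ ≤ η ∧ ρ + ρ / (2 * L) ≤ σ ∧ L * ρ ^ 2 ≤ η / 2 := by
    have h1 : ∀ᶠ ρ in 𝓝[>] (0 : ℝ), ρ < η := nhdsWithin_le_nhds (gt_mem_nhds hη)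
    have h2 : ∀ᶠ ρ in 𝓝[>] (0 : ℝ), ρ + ρ / (2 * L) < σ := by
      have : Tendsto (fun ρ : ℝ => ρ + ρ / (2 * L)) (𝓝[>] 0) (𝓝 0) := by
        have hc : Continuous fun ρ : ℝ => ρ + ρ / (2 * L) := by fun_prop
        simpa using (hc.tendsto 0).mono_left (nhdsWithin_le_nhds (s := Set.Ioi 0))
      exact this.eventually (gt_mem_nhds hσ)
    have h3 : ∀ᶠ ρ in 𝓝[>] (0 : ℝ), L * ρ ^ 2 < η / 2 := by
      have : Tendsto (fun ρ : ℝ => L * ρ ^ 2) (𝓝[>] 0) (𝓝 0) := by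
        have hc : Continuous fun ρ : ℝ => L * ρ ^ 2 := by fun_prop
        simpa using (hc.tendsto 0).mono_left (nhdsWithin_le_nhds (s := Set.Ioi 0))
      exact this.eventually (gt_mem_nhds (half_pos hη))
    obtain ⟨ρ, h1, h2, h3, h4⟩ := (h1.and (h2.and (h3.and self_mem_nhdsWithin))).exists
    exact ⟨ρ, h4, h1.le, h2.le, h3.le⟩
  have hadd : ∀ i, Continuous fun e => block i xhat + e := fun i => by fun_prop
  obtain ⟨x, z, X, hxρ, hzρ, hvz, hjet, hquad⟩ :=
    exists_superjets_of_quadratic_bound (K := fun i => {e | block i xhat + e ∈ K i}) (v := v)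
      (fun i => (Homeomorph.addLeft (block i xhat)).isCompact_preimage.2 (hKc i))
      (fun i => hKs i _ (by simpa using hxhat i) (by simpa using hs i))
      (fun i => by
        have h1 : UpperSemicontinuousOn (fun e => u i (block i xhat + e))
            {e | block i xhat + e ∈ K i} :=
          ((hu i).mono (hKO i)).comp (hadd i).continuousOn fun e he => he
        have hc : Continuous fun e : EuclideanSpace ℝ (Fin (N i)) =>
            -u i (block i xhat) - inner ℝ (block i g) e := by fun_prop
        have h2 := h1.add hc.continuousOn.upperSemicontinuousOn
        have e1 : v i = fun e => u i (block i xhat + e)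
            + (-u i (block i xhat) - inner ℝ (block i g) e) := by
          ext e; simp only [hv]; ring
        rw [e1]
        exact h2)
      (fun i => by simp [hv]) hMsymm hθpos hLpos hbound hρ
  have hz : ‖z‖ ≤ σ := by
    have h1 : ‖z - x‖ ≤ ρ / (2 * L) := by
      rw [norm_smul, Real.norm_eq_abs, abs_of_pos (by positivity)] at hzρ
      rw [le_div_iff₀ (by positivity)]
      linarith
    have h2 := norm_add_le x (z - x)
    rw [add_sub_cancel] at h2
    linarith
  refine ⟨xhat + z, (2 * L) • (z - x) + g, X, ?_, ?_, fun i => ?_, fun i => ?_, fun h => ?_⟩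
  · rw [add_sub_cancel_left]
    exact hz.trans hση
  · rw [add_sub_cancel_right]
    exact hzρ.trans hρη
  · have h1 : v i (block i z) = u i (block i xhat + block i z) - u i (block i xhat)
      - inner ℝ (block i g) (block i z) := rfl
    have h2 := hvz i
    have h3 : L * ‖block i x‖ ^ 2 ≤ L * ρ ^ 2 := by
      have := (norm_block_le x i).trans hxρ
      gcongr
    have h4 : |inner ℝ (block i g) (block i z)| ≤ ‖g‖ * σ :=
      (abs_real_inner_le_norm _ _).trans (mul_le_mul (norm_block_le g i)
        ((norm_block_le z i).trans hz) (norm_nonneg _) (norm_nonneg _))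
    rw [block_add]
    linarith [(abs_le.1 h4).1]
  · rw [block_add, block_add]
    refine superjet_of_translate (hKO i) ?_ (hjet i)
    have hzs : ‖block i z‖ < s i := ((norm_block_le z i).trans hz).trans_lt (hσs i)
    have hopen : Metric.ball (block i xhat) (s i) ∈ 𝓝 (block i xhat + block i z) :=
      Metric.isOpen_ball.mem_nhds (by rwa [mem_ball_iff_norm, add_sub_cancel_left])
    filter_upwards [nhdsWithin_le_nhds hopen, self_mem_nhdsWithin] with y hy hyO
    exact hKs i y hyO (mem_ball_iff_norm.1 hy)
  · have h1 := hquad h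
    rw [hMin, real_inner_self_eq_norm_sq] at h1
    have h2 : 0 ≤ η * ‖h‖ ^ 2 := by positivity
    constructor
    · refine le_trans ?_ h1.1
      rw [hL, hθ]
      linarith
    · rw [hθ] at h1
      linarith [h1.2]

theorem tendsto_inner_toEuclideanLin_blockDiagonal'
    {X : ℕ → (i : Fin k) → Matrix (Fin (N i)) (Fin (N i)) ℝ}
    {Y : (i : Fin k) → Matrix (Fin (N i)) (Fin (N i)) ℝ}
    (hX : ∀ i a b, Tendsto (fun n => X n i a b) atTop (𝓝 (Y i a b)))
    (h : EuclideanSpace ℝ (Σ i, Fin (N i))) :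
    Tendsto (fun n => inner ℝ (Matrix.toEuclideanLin (Matrix.blockDiagonal' (X n)) h) h) atTop
      (𝓝 (inner ℝ (Matrix.toEuclideanLin (Matrix.blockDiagonal' Y) h) h)) := by
  simp only [inner_toEuclideanLin_blockDiagonal']
  simp only [inner_toEuclideanLin_self]
  exact tendsto_finsetSum _ fun i _ => tendsto_finsetSum _ fun a _ =>
    (tendsto_finsetSum _ fun b _ => (hX i a b).mul_const _).mul_const _

end TheoremOnSums

theorem theorem3p2 {k : ℕ} {N : Fin k → ℕ}
    (O : (i : Fin k) → Set (EuclideanSpace ℝ (Fin (N i))))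
    (hO : ∀ i, LocallyCompactSpace (O i))
    (u : (i : Fin k) → EuclideanSpace ℝ (Fin (N i)) → ℝ)
    (hu : ∀ i, UpperSemicontinuousOn (u i) (O i))
    (U : Set (EuclideanSpace ℝ (Σ i, Fin (N i)))) (hU : IsOpen U) (hOU : blockProd O ⊆ U)
    (φ : EuclideanSpace ℝ (Σ i, Fin (N i)) → ℝ) (hφ : ContDiffOn ℝ 2 φ U)
    (xhat : EuclideanSpace ℝ (Σ i, Fin (N i))) (hxhat : xhat ∈ blockProd O)
    (hmax : IsLocalMaxOn (fun x => (∑ i, u i (block i x)) - φ x) (blockProd O) xhat)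
    (ε : ℝ) (hε : 0 < ε) :
    ∃ X : (i : Fin k) → Matrix (Fin (N i)) (Fin (N i)) ℝ,
      (∀ i, (X i).IsSymm) ∧
      (∀ i, (block i (gradient φ xhat), X i) ∈ closedSuperjet (O i) (u i) (block i xhat)) ∧
      (Matrix.blockDiagonal' X -
        -((1 / ε + symmNorm (hessianMatrix φ xhat)) •
          (1 : Matrix (Σ i, Fin (N i)) (Σ i, Fin (N i)) ℝ))).PosSemidef ∧
      (hessianMatrix φ xhat + ε • hessianMatrix φ xhat ^ 2 - Matrix.blockDiagonal' X).PosSemidef := by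
  have hφ' : ContDiffAt ℝ 2 φ xhat := hφ.contDiffAt (hU.mem_nhds (hOU hxhat))
  have hAsymm : (hessianMatrix φ xhat).IsSymm := hessianMatrix_isSymm hφ'
  have hη0 : Tendsto (fun n : ℕ => 1 / ((n : ℝ) + 1)) atTop (𝓝 0) :=
    tendsto_one_div_add_atTop_nhds_zero_nat
  choose z p X hz hp hlow hjet hquad using fun n : ℕ =>
    exists_approximate_superjets hO hu hφ' hxhat hmax hε (η := 1 / ((n : ℝ) + 1)) (by positivity)
  set A := hessianMatrix φ xhat with hA
  have hBsymm : (A + ε • A ^ 2).IsSymm := hAsymm.add ((hAsymm.pow 2).smul ε)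
  set B := A + ε • A ^ 2 with hB
  set Λ := 1 / ε + symmNorm A with hlam
  have hlam0 : 0 ≤ Λ := add_nonneg (by positivity) (symmNorm_nonneg A)
  set C := Λ + 1 + symmNorm B with hC
  -- The two-sided bounds on the forms are uniform in `n`, so the entries stay in a compact box.
  have hentry : ∀ n i a b, |X n i a b| ≤ C := by
    intro n i a b
    refine abs_entry_le_of_inner_le (hjet n i).2.1 (fun h => ?_) a b
    have h1 := hquad n (incl i h)
    have h2 : inner ℝ (Matrix.toEuclideanLin (Matrix.blockDiagonal' (X n)) (incl i h)) (incl i h)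
        = inner ℝ (Matrix.toEuclideanLin (X n i) h) h := by
      rw [inner_incl, block_toEuclideanLin_blockDiagonal', block_incl_self]
    have h3 := inner_toEuclideanLin_le_symmNorm hBsymm (incl i h)
    rw [norm_incl] at h1 h3
    rw [h2] at h1
    have h4 : 1 / ((n : ℝ) + 1) * ‖h‖ ^ 2 ≤ 1 * ‖h‖ ^ 2 := by
      gcongr
      rw [div_le_one (by positivity)]
      have : (0 : ℝ) ≤ n := Nat.cast_nonneg n
      linarith
    have h5 : 0 ≤ symmNorm B * ‖h‖ ^ 2 := mul_nonneg (symmNorm_nonneg B) (sq_nonneg _)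
    have h6 : 0 ≤ Λ * ‖h‖ ^ 2 := mul_nonneg hlam0 (sq_nonneg _)
    rw [hC, abs_le]
    constructor <;> linarith [h1.1, h1.2]
  set S : Set ((i : Fin k) → Fin (N i) → Fin (N i) → ℝ) :=
    Set.univ.pi fun i => Set.univ.pi fun _ => Set.univ.pi fun _ => Set.Icc (-C) C with hS
  have hScomp : IsCompact S := isCompact_univ_pi fun i => isCompact_univ_pi fun _ =>
    isCompact_univ_pi fun _ => isCompact_Icc
  obtain ⟨Y₀, -, ψ, hψ, hlim⟩ := hScomp.tendsto_subseq
    (x := fun n => (fun i a b => X n i a b)) (fun n i _ a _ b _ => abs_le.1 (hentry n i a b))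
  let Y : (i : Fin k) → Matrix (Fin (N i)) (Fin (N i)) ℝ := fun i => Matrix.of (Y₀ i)
  have hψt := hψ.tendsto_atTop
  have hXlim : ∀ i a b, Tendsto (fun n => X (ψ n) i a b) atTop (𝓝 (Y i a b)) := fun i a b =>
    tendsto_pi_nhds.1 (tendsto_pi_nhds.1 (tendsto_pi_nhds.1 hlim i) a) b
  have hYsymm : ∀ i, (Y i).IsSymm := by
    intro i
    ext a b
    refine tendsto_nhds_unique (hXlim i b a) ((hXlim i a b).congr fun n => ?_)
    exact (hjet (ψ n) i).2.1.apply _ _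
  have hYbd : (Matrix.blockDiagonal' Y).IsSymm := by
    rw [Matrix.IsSymm, Matrix.blockDiagonal'_transpose]
    congr 1
    ext1 i
    exact hYsymm i
  have hηψ : Tendsto (fun n => 1 / ((ψ n : ℝ) + 1)) atTop (𝓝 0) := hη0.comp hψt
  have hzlim : Tendsto (fun n => z (ψ n)) atTop (𝓝 xhat) := by
    rw [tendsto_iff_norm_sub_tendsto_zero]
    exact squeeze_zero (fun _ => norm_nonneg _) (fun n => hz (ψ n)) hηψ
  have hplim : Tendsto (fun n => p (ψ n)) atTop (𝓝 (gradient φ xhat)) := by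
    rw [tendsto_iff_norm_sub_tendsto_zero]
    exact squeeze_zero (fun _ => norm_nonneg _) (fun n => hp (ψ n)) hηψ
  have hblock : ∀ i, Continuous
      (fun x : EuclideanSpace ℝ (Σ i, Fin (N i)) => block i x) := by
    intro i
    unfold block
    fun_prop
  refine ⟨Y, hYsymm, fun i => ?_, ?_, ?_⟩
  · have hzi : Tendsto (fun n => block i (z (ψ n))) atTop (𝓝 (block i xhat)) :=
      ((hblock i).tendsto xhat).comp hzlim
    refine ⟨hxhat i, hYsymm i, fun n => block i (z (ψ n)), fun n => block i (p (ψ n)),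
      fun n => X (ψ n) i, fun n => ⟨(hjet (ψ n) i).1, hjet (ψ n) i⟩, hzi, ?_,
      ((hblock i).tendsto _).comp hplim, ?_⟩
    -- Upper semicontinuity gives only the upper half of the convergence of values; the lower half
    -- is the estimate `hlow`.
    · refine tendsto_order.2 ⟨fun y hy => ?_, fun y hy => ?_⟩
      · filter_upwards [hηψ.eventually (gt_mem_nhds (sub_pos.2 hy))] with n hn
        have := hlow (ψ n) i
        linarith
      · have hin : Tendsto (fun n => block i (z (ψ n))) atTop (𝓝[O i] (block i xhat)) :=
          tendsto_nhdsWithin_iff.2 ⟨hzi, Eventually.of_forall fun n => (hjet (ψ n) i).1⟩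
        exact hin.eventually (hu i _ (hxhat i) y hy)
    · exact tendsto_pi_nhds.2 fun a => tendsto_pi_nhds.2 fun b => hXlim i a b
  · refine posSemidef_of_inner_nonneg ?_ fun h => ?_
    · exact hYbd.sub ((Matrix.isSymm_one.smul _).neg)
    · have h1 := tendsto_inner_toEuclideanLin_blockDiagonal' hXlim h
      have h2 : Tendsto (fun n => -((Λ + 1 / ((ψ n : ℝ) + 1)) * ‖h‖ ^ 2)) atTop
          (𝓝 (-((Λ + 0) * ‖h‖ ^ 2))) := ((hηψ.const_add Λ).mul_const _).neg
      have h3 := le_of_tendsto_of_tendsto' h2 h1 fun n => (hquad (ψ n) h).1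
      simp only [map_sub, map_neg, map_smul, LinearMap.sub_apply, LinearMap.neg_apply,
        LinearMap.smul_apply, inner_sub_left, inner_neg_left, inner_smul_left, Matrix.toLpLin_one,
        LinearMap.id_apply, real_inner_self_eq_norm_sq, conj_trivial]
      linarith
  · refine posSemidef_of_inner_nonneg (hBsymm.sub hYbd) fun h => ?_
    have h1 := tendsto_inner_toEuclideanLin_blockDiagonal' hXlim h
    have h2 : Tendsto (fun n => inner ℝ (Matrix.toEuclideanLin B h) h
        + 1 / ((ψ n : ℝ) + 1) * ‖h‖ ^ 2) atTop
        (𝓝 (inner ℝ (Matrix.toEuclideanLin B h) h + 0 * ‖h‖ ^ 2)) :=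
      (hηψ.mul_const _).const_add _
    have h3 := le_of_tendsto_of_tendsto' h1 h2 fun n => (hquad (ψ n) h).2
    rw [map_sub, LinearMap.sub_apply, inner_sub_left]
    linarith
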